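/- Let $(\Gamma, G_0, G)$ be a CR-solvmanifold (CRS): $G$ is a connected simply connected solvable complex Lie group, $G_0$ is a (closed) connected real Lie subgroup of $G$, $\Gamma$ is a discrete cocompact subgroup of $G_0$, and the Lie algebras $\mathfrak g_0 \subset \mathfrak g$ of $G_0$ and $G$ satisfy $\mathfrak g_0 + i\mathfrak g_0 = \mathfrak g$. Put $\mathfrak m := \mathfrak g_0 \cap i\mathfrak g_0$. Suppose that the CRS is locally Kähler, i.e. that $G_0/\Gamma$ has an open neighbourhood in the complex manifold $G/\Gamma$ which carries a Kähler form. Then there is a real Lie subalgebra $\alpha_0$ of $\mathfrak g_0$ complementary to the ideal $\mathfrak m$ of $\mathfrak g_0$, i.e. $$\mathfrak g_0 = \alpha_0 \ltimes \mathfrak m, \qquad\text{and moreover}\qquad [\mathfrak g, \mathfrak m] = [\alpha_0, \mathfrak m].$$ More precisely, for every right-$G_0$-invariant Kähler form $\omega$ on a right-$G_0$-invariant open neighbourhood of $G_0$ in $G$, the $\omega$-orthogonal complement of $\mathfrak m$ in $\mathfrak g_0$, $$\alpha_0 = \{X \in \mathfrak g_0 \mid \omega(X, Y) = 0 \text{ for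 all } Y \in \mathfrak m\}$$ ($\omega$ evaluated at the identity, $\mathfrak g = T_1 G$), is a subalgebra with these properties. -/

import Mathlib

open scoped Manifold ContDiff Topology

noncomputable section

namespace CRSolv

section Forms

variable {E : Type*} [NormedAddCommGroup E] [NormedSpace ℂ E]
  {M : Type*} [TopologicalSpace M] [ChartedSpace E M]

variable (E M) in
/-- Real differential `2`-forms on a complex manifold `M` modelled on `E` (no regularity imposed):
a real alternating bilinear form on every tangent space. -/
abbrev TwoForm : Type _ :=
  ∀ x : M, TangentSpace 𝓘(ℂ, E) x [⋀^Fin 2]→L[ℝ] ℝ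

/-- The expression of a `2`-form in a chart `e`, i.e. the pullback of the form under the
inverse of `e`. -/
def TwoForm.inChart (η : TwoForm E M) (e : OpenPartialHomeomorph M E) (y : E) :
    E [⋀^Fin 2]→L[ℝ] ℝ :=
  (η (e.symm y)).compContinuousLinearMap
    ((mfderiv 𝓘(ℂ, E) 𝓘(ℂ, E) e.symm y).restrictScalars ℝ)

/-- `η` is a Kähler form on the subset `U` (in practice open) of the complex manifold `M`: it is
smooth and closed on `U`, and at every point of `U` it is invariant under the complex structure
`J = i` and `h(v, w) = η(Jv, w)` is positive definite. Values of `η` outside `U` are irrelevant. -/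
structure IsKahlerFormOn (η : TwoForm E M) (U : Set M) : Prop where
  smooth : ∀ e ∈ atlas E M, ContDiffOn ℝ ∞ (η.inChart e) (e.target ∩ e.symm ⁻¹' U)
  closed : ∀ e ∈ atlas E M, ∀ y ∈ e.target ∩ e.symm ⁻¹' U, extDeriv (η.inChart e) y = 0
  map_I_smul : ∀ x ∈ U, ∀ v w : TangentSpace 𝓘(ℂ, E) x,
    η x ![Complex.I • v, Complex.I • w] = η x ![v, w]
  pos : ∀ x ∈ U, ∀ v : TangentSpace 𝓘(ℂ, E) x, v ≠ 0 → 0 < η x ![Complex.I • v, v]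

end Forms

section Groups

variable {E : Type*} [NormedAddCommGroup E] [NormedSpace ℂ E]
  {E₀ : Type*} [NormedAddCommGroup E₀] [NormedSpace ℝ E₀]
  {G : Type*} [Group G] [TopologicalSpace G] [ChartedSpace E G]

theorem isLocalHomeomorph_mk [LieGroup 𝓘(ℂ, E) ω G] (Γ : Subgroup G) [DiscreteTopology Γ] :
    IsLocalHomeomorph (QuotientGroup.mk : G → G ⧸ Γ) := by
  have : IsTopologicalGroup G := topologicalGroup_of_lieGroup 𝓘(ℂ, E) ω
  have h : Topology.IsQuotientMap (QuotientGroup.mk : G → G ⧸ Γ) := isQuotientMap_quotient_mk'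
  exact (h.isQuotientCoveringMap_of_subgroupOp Γ ⟨inferInstance⟩
    QuotientGroup.eq).isCoveringMap.isLocalHomeomorph

/-- The complex manifold structure of `G ⧸ Γ` for a discrete subgroup `Γ` of a complex Lie group
`G`: its charts are the local inverses of the projection followed by charts of `G`. -/
@[reducible]
def quotientChartedSpace [LieGroup 𝓘(ℂ, E) ω G] (Γ : Subgroup G) [DiscreteTopology Γ] :
    ChartedSpace E (G ⧸ Γ) :=
  (isLocalHomeomorph_mk (E := E) Γ).chartedSpace QuotientGroup.mk_surjective

variable (E) in
/-- `G₀ ⧸ Γ` has an open neighbourhood in the complex manifold `G ⧸ Γ` that carries a Kähler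
form. -/
def IsLocallyKahler [LieGroup 𝓘(ℂ, E) ω G] (Γ G₀ : Subgroup G) [DiscreteTopology Γ] : Prop :=
  letI : ChartedSpace E (G ⧸ Γ) := quotientChartedSpace Γ
  ∃ (U : Set (G ⧸ Γ)) (η : TwoForm E (G ⧸ Γ)),
    IsOpen U ∧ (∀ g ∈ G₀, (QuotientGroup.mk g : G ⧸ Γ) ∈ U) ∧ IsKahlerFormOn η U

/-- `U` is a right-`G₀`-invariant open neighbourhood of `G₀` in `G` and `η` is a
right-`G₀`-invariant Kähler form on `U`. -/
structure IsInvariantKahlerForm (G₀ : Subgroup G) (η : TwoForm E G) (U : Set G) : Prop where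
  isOpen : IsOpen U
  subset : (G₀ : Set G) ⊆ U
  mul_mem : ∀ x ∈ U, ∀ g ∈ G₀, x * g ∈ U
  isKahler : IsKahlerFormOn η U
  invariant : ∀ x ∈ U, ∀ g ∈ G₀,
    (η (x * g)).compContinuousLinearMap
      ((mfderiv 𝓘(ℂ, E) 𝓘(ℂ, E) (fun y : G => y * g) x).restrictScalars ℝ) = η x

variable (E E₀) in
/-- The Lie algebra `𝔤₀` of a real Lie subgroup `G₀`, as a real subspace of the Lie algebra `𝔤` of
the complex Lie group `G`: the image of the differential of the inclusion at the identity. -/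
def lieAlg (G₀ : Subgroup G) [ChartedSpace E₀ G₀] :
    Submodule ℝ (GroupLieAlgebra 𝓘(ℂ, E) G) where
  carrier := Set.range (mfderiv 𝓘(ℝ, E₀) 𝓘(ℝ, E) (Subtype.val : G₀ → G) (1 : G₀))
  add_mem' := by
    rintro _ _ ⟨v, rfl⟩ ⟨w, rfl⟩
    exact ⟨v + w, map_add _ v w⟩
  zero_mem' := ⟨0, map_zero _⟩
  smul_mem' := by
    rintro c _ ⟨v, rfl⟩
    exact ⟨c • v, map_smul _ c v⟩

end Groups

section LieAlgebras

variable {L : Type*} [AddCommGroup L] [Module ℂ L]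

/-- The real subspace `i 𝔞` of a complex vector space. -/
def iMul (a : Submodule ℝ L) : Submodule ℝ L :=
  a.map (LinearMap.lsmul ℂ L Complex.I |>.restrictScalars ℝ)

/-- The real span `[𝔞, 𝔟]` of all brackets of elements of `𝔞` with elements of `𝔟`. -/
def bracketSpan [Bracket L L] (a b : Submodule ℝ L) : Submodule ℝ L :=
  Submodule.span ℝ {z | ∃ x ∈ a, ∃ y ∈ b, ⁅x, y⁆ = z}

/-- `𝔤 = 𝔞 ⋉ 𝔪`: the real subspace `𝔤` is the direct sum of `𝔞` and `𝔪` as a real vector space,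
`𝔞` is a subalgebra and `𝔪` is an ideal of `𝔤`. -/
structure IsSemidirectSum [Bracket L L] (g a m : Submodule ℝ L) : Prop where
  lie_mem_left : ∀ x ∈ a, ∀ y ∈ a, ⁅x, y⁆ ∈ a
  lie_mem_right : ∀ x ∈ g, ∀ y ∈ m, ⁅x, y⁆ ∈ m
  inf_eq : a ⊓ m = ⊥
  sup_eq : a ⊔ m = g

end LieAlgebras

section CRS

variable {E : Type*} [NormedAddCommGroup E] [NormedSpace ℂ E]
  {E₀ : Type*} [NormedAddCommGroup E₀] [NormedSpace ℝ E₀]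
  {G : Type*} [Group G] [TopologicalSpace G] [ChartedSpace E G]

variable (E E₀) in
/-- `𝔪 = 𝔤₀ ∩ i 𝔤₀`. -/
def complexPart (G₀ : Subgroup G) [ChartedSpace E₀ G₀] :
    Submodule ℝ (GroupLieAlgebra 𝓘(ℂ, E) G) :=
  lieAlg E E₀ G₀ ⊓ iMul (lieAlg E E₀ G₀)

variable (E₀) in
/-- The `η`-orthogonal complement of `𝔪` in `𝔤₀`, formed at the identity of `G`. -/
def orthogonalComplement (G₀ : Subgroup G) [ChartedSpace E₀ G₀] (η : TwoForm E G) :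
    Submodule ℝ (GroupLieAlgebra 𝓘(ℂ, E) G) where
  carrier := {x | x ∈ lieAlg E E₀ G₀ ∧ ∀ y ∈ complexPart E E₀ G₀, η 1 ![x, y] = 0}
  add_mem' := by
    rintro x x' ⟨hx, hx'⟩ ⟨hy, hy'⟩
    refine ⟨add_mem hx hy, fun y h => ?_⟩
    have := (η 1).toMultilinearMap.cons_add ![y] x x'
    exact this.trans (by simpa using congrArg₂ (· + ·) (hx' y h) (hy' y h))
  zero_mem' := ⟨zero_mem _, fun y _ => (η 1).map_coord_zero 0 rfl⟩
  smul_mem' := by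
    rintro c x ⟨hx, hx'⟩
    refine ⟨Submodule.smul_mem _ c hx, fun y h => ?_⟩
    have := (η 1).toMultilinearMap.cons_smul ![y] c x
    exact this.trans (by simpa using Or.inr (hx' y h))

variable (E E₀) in
/-- `(Γ, G₀, G)` is a CR-solvmanifold: `G` is a simply connected solvable complex Lie group, `G₀`
is a connected real Lie subgroup (a Lie group in the subspace topology, immersed in `G` by the
inclusion), `Γ` is a discrete cocompact subgroup of `G₀`, and `𝔤₀ + i 𝔤₀ = 𝔤`. -/
structure IsCRS [LieGroup 𝓘(ℂ, E) ω G] (Γ G₀ : Subgroup G) [DiscreteTopology Γ]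
    [ChartedSpace E₀ G₀] [LieGroup 𝓘(ℝ, E₀) ∞ G₀] : Prop where
  solvable : Group.IsSolvable G
  simplyConnected : SimplyConnectedSpace G
  connected₀ : ConnectedSpace G₀
  smooth_val : ContMDiff 𝓘(ℝ, E₀) 𝓘(ℝ, E) ∞ (Subtype.val : G₀ → G)
  injective_mfderiv_val : ∀ g : G₀,
    Function.Injective (mfderiv 𝓘(ℝ, E₀) 𝓘(ℝ, E) (Subtype.val : G₀ → G) g)
  le : Γ ≤ G₀
  cocompact : CompactSpace (G₀ ⧸ Γ.subgroupOf G₀)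
  generic : lieAlg E E₀ G₀ ⊔ iMul (lieAlg E E₀ G₀) = ⊤

end CRS

end CRSolv

end

/-! Everything reduces to linear algebra once there is a real alternating form `w` on 𝔤 that is
invariant under `i`, has `w(ix, x) > 0` for `x ≠ 0`, and satisfies the cocycle identity on 𝔤₀. The
space 𝔪 is stable under `i` and is an ideal of 𝔤₀. Comparing the cocycle identity for `(x, y, i[x,
y])` and `(ix, iy, i[x, y])` forces 𝔪 to be abelian (`lie_eq_zero_of_isCocycleOn`). By positivity
`w` is nondegenerate on 𝔪, so its orthogonal in 𝔤₀ is a complement of 𝔪; the cocycle identity with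
one argument in 𝔪 makes it a subalgebra. Since 𝔪 is abelian, only this complement contributes to
`[𝔤₀, 𝔪]`, and `[ix, y] = [x, iy]` extends this to 𝔤 = 𝔤₀ + i𝔤₀ (`isSemidirectSum_orthogonal`).

An invariant Kähler form gives such a `w` by evaluation at the identity: its translates along G₀ are
constant, so closedness becomes the cocycle identity (`IsInvariantKahlerForm.cyclic_sum_eq_zero`).

For existence, the given form near G₀/Γ need not be invariant and is averaged
(`exists_averaged_form`). Pulling it back under `x ↦ xgΓ` and evaluating at 1 gives forms `W_g` on
𝔤, right-Γ-invariant in `g ∈ G₀`, hence bounded, with uniform positivity because G₀/Γ is compact. As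
G₀ is solvable there is a left-invariant mean (`exists_invariant_mean`), and `w` is the mean of
`W_g`. Closedness writes the cocycle expression of `W_g` as a sum of derivatives of `W` at `g` along
curves `γ(t)g` (`exists_hasFDerivAt_transForm_mul`). By compactness the difference quotients
converge uniformly in `g`, and their means vanish by invariance, so the mean of the derivatives
vanishes too. -/

noncomputable section

namespace CRSolv

set_option linter.unusedSectionVars false

/-! ### Amenability of solvable groups, by Hahn–Banach -/

section InvariantMean

variable {V : Type*} [AddCommGroup V] [Module ℝ V]

/-- A sublinear functional on a real vector space. -/
structure IsSublinear (p : V → ℝ) : Prop where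
  smul : ∀ c : ℝ, 0 < c → ∀ x, p (c • x) = c * p x
  add : ∀ x y, p (x + y) ≤ p x + p y

namespace IsSublinear

variable {p : V → ℝ}

theorem zero (hp : IsSublinear p) : p 0 = 0 := by
  have := hp.smul 2 two_pos 0
  rw [smul_zero] at this
  linarith

theorem smul_of_nonneg (hp : IsSublinear p) {c : ℝ} (hc : 0 ≤ c) (x : V) :
    p (c • x) = c * p x := by
  rcases hc.eq_or_lt with rfl | h
  · simp [hp.zero]
  · exact hp.smul c h x

theorem neg_le (hp : IsSublinear p) (x : V) : -p (-x) ≤ p x := by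
  have := hp.add x (-x)
  rw [add_neg_cancel, hp.zero] at this
  linarith

theorem le_add_sub (hp : IsSublinear p) (x y : V) : p x ≤ p y + p (x - y) := by
  simpa using hp.add y (x - y)

theorem convex_le (hp : IsSublinear p) {W : Type*} [AddCommGroup W] [Module ℝ W]
    (f : W →ₗ[ℝ] V) (C : ℝ) : Convex ℝ {T | p (f T) ≤ C} := by
  intro S hS T hT a b ha hb hab
  simp only [Set.mem_ofPred_eq, map_add, map_smul] at *
  calc p (a • f S + b • f T) ≤ a * p (f S) + b * p (f T) := by
        simpa only [hp.smul_of_nonneg ha, hp.smul_of_nonneg hb] using hp.add (a • f S) (b • f T)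
    _ ≤ a * C + b * C := by gcongr
    _ = C := by rw [← add_mul, hab, one_mul]

end IsSublinear

variable {H : Type*} [Group H]

/-- If a sublinear functional is invariant under a group of operators that commute up to vectors on
which it is nonpositive, it dominates an invariant linear functional. -/
theorem exists_invariant_le_of_commute {p : V → ℝ} (hp : IsSublinear p)
    (ρ : H →* Module.End ℝ V) (hρ : ∀ h x, p (ρ h x) ≤ p x)
    (hcomm : ∀ s t x, p (ρ s (ρ t x) - ρ t (ρ s x)) ≤ 0) :
    ∃ Λ : V →ₗ[ℝ] ℝ, (∀ x, Λ x ≤ p x) ∧ ∀ h x, Λ (ρ h x) = Λ x := by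
  let A : Set (Module.End ℝ V) := convexHull ℝ (Set.range ρ)
  -- Sublinear conditions on an operator define convex sets, so they pass from the group to its
  -- convex hull.
  have hA : ∀ T ∈ A, ∀ x, p (T x) ≤ p x := fun T hT x =>
    convexHull_min (t := {T : Module.End ℝ V | p (LinearMap.applyₗ x T) ≤ p x})
      (by rintro _ ⟨h, rfl⟩; exact hρ h x) (hp.convex_le _ _) hT
  have hAcomm : ∀ S ∈ A, ∀ T ∈ A, ∀ x, p (S (T x) - T (S x)) ≤ 0 := by
    intro S hS T hT x
    let f : Module.End ℝ V → Module.End ℝ V →ₗ[ℝ] V := fun T =>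
      LinearMap.applyₗ (T x) - T ∘ₗ LinearMap.applyₗ x
    let g : Module.End ℝ V → Module.End ℝ V →ₗ[ℝ] V := fun S =>
      S ∘ₗ LinearMap.applyₗ x - LinearMap.applyₗ (S x)
    refine convexHull_min (t := {S | p (f T S) ≤ 0}) ?_ (hp.convex_le _ _) hS
    rintro _ ⟨s, rfl⟩
    refine convexHull_min (t := {T | p (g (ρ s) T) ≤ 0}) ?_ (hp.convex_le _ _) hT
    rintro _ ⟨t, rfl⟩
    exact hcomm s t x
  have hAmul : ∀ S ∈ A, ∀ T ∈ A, S * T ∈ A := by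
    intro S hS T hT
    refine convexHull_min (t := (LinearMap.mulRight ℝ T) ⁻¹' A) ?_
      ((convex_convexHull ℝ _).linear_preimage _) hS
    rintro _ ⟨s, rfl⟩
    refine convexHull_min (t := (LinearMap.mulLeft ℝ (ρ s)) ⁻¹' A) ?_
      ((convex_convexHull ℝ _).linear_preimage _) hT
    rintro _ ⟨t, rfl⟩
    exact subset_convexHull ℝ _ ⟨s * t, map_mul ρ s t⟩
  let W : Submodule ℝ V := Submodule.span ℝ {w | ∃ h x, x - ρ h x = w}
  -- Markov–Kakutani: convex combinations of group operators make every element of `W` arbitrarily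
  -- small for `p`, in both signs.
  have key : ∀ w ∈ W, ∀ ε > 0, ∃ T ∈ A, p (T w) ≤ ε ∧ p (-T w) ≤ ε := by
    intro w hw
    induction hw using Submodule.span_induction with
    | mem w hw =>
      obtain ⟨h, x, rfl⟩ := hw
      intro ε hε
      obtain ⟨n, hn⟩ := exists_nat_gt ((p x + p (-x)) / ε)
      let N : ℕ := n + 1
      have hN : (0 : ℝ) < N := by positivity
      -- The Cesàro average telescopes on `x - ρ h x`, leaving two terms divided by `N`.
      let T : Module.End ℝ V := ∑ k ∈ Finset.range N, (1 / N : ℝ) • ρ (h ^ k)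
      have hT : T ∈ A := by
        refine (convex_convexHull ℝ _).sum_mem (fun _ _ => by positivity) ?_
          fun k _ => subset_convexHull ℝ _ ⟨_, rfl⟩
        simp [hN.ne']
      have hTx : T (x - ρ h x) = (1 / N : ℝ) • (x - ρ (h ^ N) x) := by
        have h1 : ∀ y, T y = (1 / N : ℝ) • ∑ k ∈ Finset.range N, ρ (h ^ k) y := by
          intro y
          simp [T, Finset.smul_sum]
        rw [h1]
        congr 1
        have h2 : ∀ k, ρ (h ^ k) (x - ρ h x) = ρ (h ^ k) x - ρ (h ^ (k + 1)) x := by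
          intro k
          rw [map_sub, pow_succ, map_mul]
          rfl
        simp_rw [h2]
        rw [Finset.sum_range_sub']
        simp
      have hbd : (1 / N : ℝ) * (p x + p (-x)) ≤ ε := by
        rw [div_lt_iff₀ hε] at hn
        rw [one_div, inv_mul_le_iff₀ hN]
        have : (N : ℝ) = n + 1 := by simp [N]
        rw [this]
        linarith
      refine ⟨T, hT, ?_, ?_⟩
      · rw [hTx, hp.smul _ (by positivity)]
        refine le_trans ?_ hbd
        gcongr
        have h3 := hp.add x (-ρ (h ^ N) x)
        rw [← sub_eq_add_neg, ← map_neg] at h3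
        linarith [hρ (h ^ N) (-x)]
      · rw [hTx, ← smul_neg, hp.smul _ (by positivity)]
        refine le_trans ?_ hbd
        gcongr
        have h3 := hp.add (ρ (h ^ N) x) (-x)
        rw [← sub_eq_add_neg] at h3
        rw [neg_sub]
        linarith [hρ (h ^ N) x]
    | zero => exact fun ε hε => ⟨ρ 1, subset_convexHull ℝ _ ⟨1, rfl⟩, by simp [hp.zero, hε.le]⟩
    | add u v _ _ hu hv =>
      intro ε hε
      obtain ⟨S, hS, h1, h2⟩ := hu (ε / 2) (by positivity)
      obtain ⟨T, hT, h3, h4⟩ := hv (ε / 2) (by positivity)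
      -- `S` shrinks `u` and `T` shrinks `v`; on `v` the two are interchanged at no cost by
      -- `hAcomm`, and the operator applied last does not increase `p`.
      refine ⟨T * S, hAmul _ hT _ hS, ?_, ?_⟩
      · have e1 := hp.add (T (S u)) (T (S v))
        have e2 := hp.le_add_sub (T (S v)) (S (T v))
        have e3 := hAcomm T hT S hS v
        have e4 := hA T hT (S u)
        have e5 := hA S hS (T v)
        simp only [Module.End.mul_apply, map_add]
        linarith
      · have e1 := hp.add (T (S (-u))) (T (S (-v)))
        have e2 := hp.le_add_sub (T (S (-v))) (S (T (-v)))
        have e3 := hAcomm T hT S hS (-v)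
        have e4 := hA T hT (S (-u))
        have e5 := hA S hS (T (-v))
        simp only [Module.End.mul_apply, map_add, map_neg, neg_add] at *
        linarith
    | smul c u _ hu =>
      intro ε hε
      obtain ⟨T, hT, h1, h2⟩ := hu (ε / (|c| + 1)) (by positivity)
      have hc : |c| * (ε / (|c| + 1)) ≤ ε := by
        rw [mul_div_assoc', div_le_iff₀ (by positivity)]
        nlinarith [abs_nonneg c]
      refine ⟨T, hT, ?_⟩
      rw [map_smul]
      rcases le_total 0 c with h | h
      · rw [← smul_neg, hp.smul_of_nonneg h, hp.smul_of_nonneg h]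
        rw [abs_of_nonneg h] at hc h1 h2
        exact ⟨(mul_le_mul_of_nonneg_left h1 h).trans hc,
          (mul_le_mul_of_nonneg_left h2 h).trans hc⟩
      · have h' : 0 ≤ -c := by linarith
        have : c • T u = (-c) • (-T u) := by simp
        rw [← neg_smul, this, hp.smul_of_nonneg h', hp.smul_of_nonneg h']
        rw [abs_of_nonpos h] at hc h1 h2
        exact ⟨(mul_le_mul_of_nonneg_left h2 h').trans hc,
          (mul_le_mul_of_nonneg_left h1 h').trans hc⟩
  -- Hence the zero functional on `W` lies below `p`, and any Hahn–Banach extension of it is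
  -- invariant.
  have hW : ∀ w ∈ W, 0 ≤ p w := by
    intro w hw
    refine le_of_forall_pos_le_add fun ε hε => ?_
    obtain ⟨T, hT, -, h2⟩ := key w hw ε hε
    have := hA T hT w
    have := hp.neg_le (T w)
    linarith
  obtain ⟨Λ, h1, h2⟩ := exists_extension_of_le_sublinear ⟨W, 0⟩ p hp.smul hp.add
    (fun w => by simpa using hW w w.2)
  refine ⟨Λ, h2, fun h x => ?_⟩
  have h3 := h1 ⟨x - ρ h x, Submodule.subset_span ⟨h, x, rfl⟩⟩
  have h4 : Λ (x - ρ h x) = 0 := h3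
  rw [map_sub] at h4
  linarith

/-- The supremum `q` of the `N`-invariant functionals below `p` is sublinear, and normality of `N`
keeps it from increasing under `H`. Commutators of `M` lie in `N`, which these functionals do not
see, so for `q` the operators of `M` commute and the commuting case applies. -/
theorem exists_invariant_le_of_commutator_le {p : V → ℝ}
    (ρ : H →* Module.End ℝ V) (hρ : ∀ h x, p (ρ h x) ≤ p x) (N M : Subgroup H) [N.Normal]
    (hNM : ⁅M, M⁆ ≤ N)
    (hN : ∃ Λ : V →ₗ[ℝ] ℝ, (∀ x, Λ x ≤ p x) ∧ ∀ h ∈ N, ∀ x, Λ (ρ h x) = Λ x) :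
    ∃ Λ : V →ₗ[ℝ] ℝ, (∀ x, Λ x ≤ p x) ∧ ∀ h ∈ M, ∀ x, Λ (ρ h x) = Λ x := by
  let S := {Λ : V →ₗ[ℝ] ℝ // (∀ x, Λ x ≤ p x) ∧ ∀ h ∈ N, ∀ x, Λ (ρ h x) = Λ x}
  have : Nonempty S := let ⟨Λ, h⟩ := hN; ⟨⟨Λ, h⟩⟩
  let q : V → ℝ := fun x => ⨆ Λ : S, Λ.1 x
  have hbdd : ∀ x, BddAbove (Set.range fun Λ : S => Λ.1 x) := fun x =>
    ⟨p x, by rintro _ ⟨Λ, rfl⟩; exact Λ.2.1 x⟩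
  have hqp : ∀ x, q x ≤ p x := fun x => ciSup_le fun Λ => Λ.2.1 x
  have hq : IsSublinear q := by
    refine ⟨fun c hc x => ?_, fun x y => ciSup_le fun Λ => ?_⟩
    · simp only [q, map_smul, smul_eq_mul]
      rw [Real.mul_iSup_of_nonneg hc.le]
    · rw [map_add]
      exact add_le_add (le_ciSup (hbdd x) Λ) (le_ciSup (hbdd y) Λ)
  have hqρ : ∀ h x, q (ρ h x) ≤ q x := by
    intro h x
    refine ciSup_le fun Λ => ?_
    have h1 : ∀ y, (Λ.1 ∘ₗ ρ h) y ≤ p y := fun y => (Λ.2.1 _).trans (hρ h y)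
    refine le_ciSup (hbdd x) (⟨Λ.1 ∘ₗ ρ h, h1, fun n hn y => ?_⟩ : S)
    have h2 := Λ.2.2 (h * n * h⁻¹) (Subgroup.Normal.conj_mem ‹_› n hn h) (ρ h y)
    rw [← Module.End.mul_apply, ← map_mul, inv_mul_cancel_right, map_mul] at h2
    exact h2
  obtain ⟨Λ, h1, h2⟩ := exists_invariant_le_of_commute hq (ρ.comp M.subtype)
    (fun h x => hqρ h x) (fun s t x => ciSup_le fun Λ => by
      have h3 : Λ.1 (ρ ((s : H) * t * (s : H)⁻¹ * (t : H)⁻¹ * (t * s)) x) = Λ.1 (ρ t (ρ s x)) := by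
        rw [map_mul, map_mul _ (t : H)]
        exact Λ.2.2 _ (hNM (Subgroup.commutator_mem_commutator s.2 t.2)) _
      have h4 : (s : H) * t * (s : H)⁻¹ * (t : H)⁻¹ * (t * s) = s * t := by simp [mul_assoc]
      rw [h4, map_mul] at h3
      rw [map_sub]
      exact (sub_eq_zero.2 h3).le)
  exact ⟨Λ, fun x => (h1 x).trans (hqp x), fun h hh x => h2 ⟨h, hh⟩ x⟩

/-- Climb the derived series from the trivial subgroup, where Hahn–Banach suffices; each step
crosses an abelian quotient. -/
theorem exists_invariant_le {p : V → ℝ} (hp : IsSublinear p) (hH : Group.IsSolvable H)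
    (ρ : H →* Module.End ℝ V) (hρ : ∀ h x, p (ρ h x) ≤ p x) :
    ∃ Λ : V →ₗ[ℝ] ℝ, (∀ x, Λ x ≤ p x) ∧ ∀ h x, Λ (ρ h x) = Λ x := by
  obtain ⟨n, hn⟩ := hH.solvable
  have key : ∀ k ≤ n, ∃ Λ : V →ₗ[ℝ] ℝ,
      (∀ x, Λ x ≤ p x) ∧ ∀ h ∈ derivedSeries H (n - k), ∀ x, Λ (ρ h x) = Λ x := by
    intro k
    induction k with
    | zero =>
      intro _
      obtain ⟨Λ, -, h⟩ := exists_extension_of_le_sublinear ⟨⊥, 0⟩ p hp.smul hp.add (by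
        rintro ⟨x, hx⟩
        obtain rfl : x = 0 := hx
        simp [hp.zero])
      refine ⟨Λ, h, fun h hh x => ?_⟩
      rw [Nat.sub_zero, hn, Subgroup.mem_bot] at hh
      simp [hh]
    | succ k ih =>
      intro hk
      refine exists_invariant_le_of_commutator_le ρ hρ (derivedSeries H (n - k)) _ ?_
        (ih (by omega))
      rw [← derivedSeries_succ, show n - (k + 1) + 1 = n - k by omega]
  obtain ⟨Λ, h1, h2⟩ := key n le_rfl
  exact ⟨Λ, h1, fun h => h2 h (by simp)⟩

/-- Solvable groups are amenable: there is a left-invariant mean on bounded functions (extended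
to a linear functional on all functions). -/
theorem exists_invariant_mean (hH : Group.IsSolvable H) :
    ∃ M : (H → ℝ) →ₗ[ℝ] ℝ, ∀ f : H → ℝ, (∃ B, ∀ g, |f g| ≤ B) →
      (∀ C, (∀ g, f g ≤ C) → M f ≤ C) ∧ ∀ h, M (fun g => f (h * g)) = M f := by
  let V : Submodule ℝ (H → ℝ) :=
    { carrier := {f | ∃ B, ∀ g, |f g| ≤ B}
      add_mem' := by
        rintro f f' ⟨B, hB⟩ ⟨B', hB'⟩
        exact ⟨B + B', fun g => (abs_add_le _ _).trans (add_le_add (hB g) (hB' g))⟩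
      zero_mem' := ⟨0, by simp⟩
      smul_mem' := by
        rintro c f ⟨B, hB⟩
        refine ⟨|c| * B, fun g => ?_⟩
        rw [Pi.smul_apply, smul_eq_mul, abs_mul]
        exact mul_le_mul_of_nonneg_left (hB g) (abs_nonneg c) }
  let L : H → V →ₗ[ℝ] V := fun h => (LinearMap.funLeft ℝ ℝ (h⁻¹ * · : H → H)).restrict
    (fun f ⟨B, hB⟩ => ⟨B, fun g => hB _⟩)
  have hL : ∀ h (f : V) g, (L h f : H → ℝ) g = (f : H → ℝ) (h⁻¹ * g) := fun _ _ _ => rfl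
  let ρ : H →* Module.End ℝ V :=
    { toFun := L
      map_one' := by ext f g; simp [hL]
      map_mul' := fun h k => by ext f g; simp [hL, mul_assoc] }
  let p : V → ℝ := fun f => ⨆ g, (f : H → ℝ) g
  have hbdd : ∀ f : V, BddAbove (Set.range (f : H → ℝ)) := by
    rintro ⟨f, B, hB⟩
    exact ⟨B, by rintro _ ⟨g, rfl⟩; exact (le_abs_self _).trans (hB g)⟩
  have hp : IsSublinear p := by
    refine ⟨fun c hc f => ?_, fun f f' => ciSup_le fun g => ?_⟩
    · simp only [p, Submodule.coe_smul, Pi.smul_apply, smul_eq_mul]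
      rw [Real.mul_iSup_of_nonneg hc.le]
    · exact add_le_add (le_ciSup (hbdd f) g) (le_ciSup (hbdd f') g)
  obtain ⟨Λ, h1, h2⟩ := exists_invariant_le hp hH ρ
    (fun h f => ciSup_le fun g => le_ciSup (hbdd f) (h⁻¹ * g))
  -- An arbitrary linear extension to unbounded functions; it spares boundedness proofs whenever
  -- only linearity is used.
  obtain ⟨M, hM⟩ := Λ.exists_extend
  have hM' : ∀ f : V, M f = Λ f := fun f => LinearMap.congr_fun hM f
  refine ⟨M, fun f hf => ⟨fun C hC => ?_, fun h => ?_⟩⟩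
  · rw [hM' ⟨f, hf⟩]
    exact (h1 _).trans (ciSup_le hC)
  · have h3 := h2 h⁻¹ ⟨f, hf⟩
    rw [← hM', ← hM'] at h3
    have : ((ρ h⁻¹ ⟨f, hf⟩ : V) : H → ℝ) = fun g => f (h * g) := by
      ext g
      change f (h⁻¹⁻¹ * g) = _
      rw [inv_inv]
    rw [this] at h3
    exact h3

end InvariantMean

/-! ### Linear algebra of cocycles that are Kähler -/

section ClosedForms

variable {L : Type*} [LieRing L] [LieAlgebra ℂ L]

theorem I_smul_mem_inf_iMul {a : Submodule ℝ L} {x : L} (hx : x ∈ a ⊓ iMul a) :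
    Complex.I • x ∈ a ⊓ iMul a := by
  obtain ⟨h1, y, hy, rfl⟩ := hx
  refine ⟨?_, _, h1, rfl⟩
  have : Complex.I • Complex.I • y = -y := by rw [smul_smul, Complex.I_mul_I, neg_one_smul]
  change Complex.I • Complex.I • y ∈ a
  rw [this]
  exact neg_mem hy

theorem lie_mem_inf_iMul {a : Submodule ℝ L} (ha : ∀ x ∈ a, ∀ y ∈ a, ⁅x, y⁆ ∈ a)
    {x y : L} (hx : x ∈ a) (hy : y ∈ a ⊓ iMul a) : ⁅x, y⁆ ∈ a ⊓ iMul a := by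
  refine ⟨ha x hx y hy.1, ?_⟩
  obtain ⟨-, z, hz, rfl⟩ := hy
  exact ⟨⁅x, z⁆, ha x hx z hz, (lie_smul Complex.I x z).symm⟩

/-- The cocycle condition: `w` is closed on the real subspace `a` of a Lie algebra. -/
def IsCocycleOn (w : L [⋀^Fin 2]→ₗ[ℝ] ℝ) (a : Submodule ℝ L) : Prop :=
  ∀ x ∈ a, ∀ y ∈ a, ∀ z ∈ a, w ![⁅x, y⁆, z] + w ![⁅y, z⁆, x] + w ![⁅z, x⁆, y] = 0

/-- The `w`-orthogonal complement of `a ∩ i a` in `a`. -/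
def orthogonal (w : L [⋀^Fin 2]→ₗ[ℝ] ℝ) (a : Submodule ℝ L) : Submodule ℝ L where
  carrier := {x | x ∈ a ∧ ∀ y ∈ a ⊓ iMul a, w ![x, y] = 0}
  add_mem' := by
    rintro x x' ⟨hx, hx'⟩ ⟨hy, hy'⟩
    refine ⟨add_mem hx hy, fun y h => ?_⟩
    have := w.toMultilinearMap.cons_add ![y] x x'
    exact this.trans (by simpa using congrArg₂ (· + ·) (hx' y h) (hy' y h))
  zero_mem' := ⟨zero_mem _, fun y _ => w.map_coord_zero 0 rfl⟩
  smul_mem' := by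
    rintro c x ⟨hx, hx'⟩
    refine ⟨Submodule.smul_mem _ c hx, fun y h => ?_⟩
    have := w.toMultilinearMap.cons_smul ![y] c x
    exact this.trans (by simpa using Or.inr (hx' y h))

theorem alternating_swap (w : L [⋀^Fin 2]→ₗ[ℝ] ℝ) (x y : L) : w ![y, x] = -w ![x, y] := by
  have := w.map_swap ![x, y] (i := 0) (j := 1) (by decide)
  rw [← this]
  congr 1
  ext i
  fin_cases i <;> rfl

theorem alternating_add (w : L [⋀^Fin 2]→ₗ[ℝ] ℝ) (x x' y : L) :
    w ![x + x', y] = w ![x, y] + w ![x', y] :=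
  w.toMultilinearMap.cons_add ![y] x x'

theorem alternating_smul (w : L [⋀^Fin 2]→ₗ[ℝ] ℝ) (c : ℝ) (x y : L) :
    w ![c • x, y] = c * w ![x, y] :=
  w.toMultilinearMap.cons_smul ![y] c x

theorem alternating_neg (w : L [⋀^Fin 2]→ₗ[ℝ] ℝ) (x y : L) :
    w ![-x, y] = -w ![x, y] := by
  simpa using alternating_smul w (-1) x y

variable {w : L [⋀^Fin 2]→ₗ[ℝ] ℝ} {a : Submodule ℝ L}

/-- A complex Lie algebra with a closed Kähler form is abelian. -/
theorem lie_eq_zero_of_isCocycleOn (ha : ∀ x ∈ a, ∀ y ∈ a, ⁅x, y⁆ ∈ a) (hw : IsCocycleOn w a)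
    (hI : ∀ x y, w ![Complex.I • x, Complex.I • y] = w ![x, y])
    (hpos : ∀ x, x ≠ 0 → 0 < w ![Complex.I • x, x]) {x y : L}
    (hx : x ∈ a ⊓ iMul a) (hy : y ∈ a ⊓ iMul a) : ⁅x, y⁆ = 0 := by
  by_contra h
  have hxy := lie_mem_inf_iMul ha hx.1 hy
  have hz := (I_smul_mem_inf_iMul hxy).1
  obtain ⟨z, hzdef⟩ : ∃ z, z = Complex.I • ⁅x, y⁆ := ⟨_, rfl⟩
  rw [← hzdef] at hz
  have h1 := hw x hx.1 y hy.1 z hz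
  -- Passing to `(ix, iy)` negates the first term of the identity and, by `hI`, preserves the other
  -- two; hence `w([x, y], i[x, y]) = 0`.
  have h2 := hw _ (I_smul_mem_inf_iMul hx).1 _ (I_smul_mem_inf_iMul hy).1 z hz
  have e1 : ⁅Complex.I • x, Complex.I • y⁆ = -⁅x, y⁆ := by
    rw [smul_lie, lie_smul, smul_smul, Complex.I_mul_I, neg_one_smul]
  rw [e1, smul_lie, lie_smul, hI, hI, alternating_neg] at h2
  have h3 := hpos _ h
  rw [← hzdef, alternating_swap] at h3
  linarith

/-- Let `w` be a closed form on `𝔤₀` that is Kähler on `𝔪 = 𝔤₀ ∩ i 𝔤₀`. Then the `w`-orthogonal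
complement of `𝔪` is a subalgebra complementary to `𝔪`, and `[𝔤, 𝔪]` is generated by it. -/
theorem isSemidirectSum_orthogonal [FiniteDimensional ℝ L]
    (ha : ∀ x ∈ a, ∀ y ∈ a, ⁅x, y⁆ ∈ a) (htop : a ⊔ iMul a = ⊤) (hw : IsCocycleOn w a)
    (hI : ∀ x y, w ![Complex.I • x, Complex.I • y] = w ![x, y])
    (hpos : ∀ x, x ≠ 0 → 0 < w ![Complex.I • x, x]) :
    IsSemidirectSum a (orthogonal w a) (a ⊓ iMul a) ∧
      bracketSpan ⊤ (a ⊓ iMul a) = bracketSpan (orthogonal w a) (a ⊓ iMul a) := by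
  set m := a ⊓ iMul a with hm
  have hinf : orthogonal w a ⊓ m = ⊥ := by
    rw [eq_bot_iff]
    rintro x ⟨⟨hx, hx'⟩, hxm⟩
    by_contra h
    have h1 := hpos x h
    have h2 := hx' _ (I_smul_mem_inf_iMul hxm)
    rw [alternating_swap, h2] at h1
    simp at h1
  have hsup : orthogonal w a ⊔ m = a := by
    refine le_antisymm (sup_le (fun x hx => hx.1) inf_le_left) fun x hx => ?_
    let φ : L →ₗ[ℝ] Module.Dual ℝ m := LinearMap.mk₂ ℝ (fun x (y : m) => w ![x, y])
      (fun x x' y => alternating_add w x x' y) (fun c x y => alternating_smul w c x y)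
      (fun x y y' => by
        rw [alternating_swap, Submodule.coe_add, alternating_add, alternating_swap w x,
          alternating_swap w x]
        ring)
      (fun c x y => by
        rw [alternating_swap, Submodule.coe_smul, alternating_smul, alternating_swap w x]
        simp)
    -- Nondegeneracy on `m`: test `y` against `iy`. By equality of dimensions, `w(x, ·)` on `m` is
    -- then represented by some `y ∈ m`, and `x - y` is orthogonal to `m`.
    have hφ : Function.Injective (φ ∘ₗ m.subtype) := by
      rw [← LinearMap.ker_eq_bot, LinearMap.ker_eq_bot']
      intro y hy
      by_contra h
      have h1 := hpos y (fun h' => h (Subtype.ext h'))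
      have h2 : w ![(y : L), Complex.I • (y : L)] = 0 :=
        LinearMap.congr_fun hy ⟨_, I_smul_mem_inf_iMul y.2⟩
      rw [alternating_swap, h2] at h1
      simp at h1
    have hs : Function.Surjective (φ ∘ₗ m.subtype) :=
      (LinearMap.injective_iff_surjective_of_finrank_eq_finrank
        Subspace.dual_finrank_eq.symm).1 hφ
    obtain ⟨y, hy⟩ := hs (φ x)
    refine Submodule.mem_sup.2 ⟨x - y, ⟨sub_mem hx y.2.1, fun z hz => ?_⟩, y, y.2, by simp⟩
    have h1 : w ![(y : L), z] = w ![x, z] := LinearMap.congr_fun hy ⟨z, hz⟩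
    rw [sub_eq_add_neg, alternating_add, alternating_neg, h1, add_neg_cancel]
  refine ⟨⟨?_, fun x hx y hy => lie_mem_inf_iMul ha hx hy, hinf, hsup⟩, ?_⟩
  · rintro x ⟨hx, hx'⟩ y ⟨hy, hy'⟩
    refine ⟨ha x hx y hy, fun z hz => ?_⟩
    -- Two terms vanish because `m` is an ideal orthogonal to `x` and `y`; what remains is `w([x,
    -- y], z)`.
    have h1 := hw x hx y hy z hz.1
    have h2 := hx' _ (lie_mem_inf_iMul ha hy hz)
    have h3 := hy' _ (lie_mem_inf_iMul ha hx hz)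
    rw [alternating_swap w x ⁅y, z⁆, h2, ← lie_skew z x, alternating_neg, alternating_swap w y,
      h3] at h1
    linarith
  · have key : ∀ x ∈ a, ∀ y ∈ m, ⁅x, y⁆ ∈ bracketSpan (orthogonal w a) m := by
      intro x hx y hy
      rw [← hsup] at hx
      obtain ⟨u, hu, v, hv, rfl⟩ := Submodule.mem_sup.1 hx
      rw [add_lie, lie_eq_zero_of_isCocycleOn ha hw hI hpos hv hy, add_zero]
      exact Submodule.subset_span ⟨u, hu, y, hy, rfl⟩
    refine le_antisymm (Submodule.span_le.2 ?_) (Submodule.span_mono ?_)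
    · rintro _ ⟨x, -, y, hy, rfl⟩
      have hx : x ∈ a ⊔ iMul a := htop ▸ Submodule.mem_top
      obtain ⟨u, hu, _, ⟨v, hv, rfl⟩, rfl⟩ := Submodule.mem_sup.1 hx
      rw [add_lie]
      refine add_mem (key u hu y hy) ?_
      -- Complex bilinearity gives `[iv, y] = [v, iy]`, and `iy` is again in `m`.
      have := key v hv _ (I_smul_mem_inf_iMul hy)
      rw [lie_smul, ← smul_lie] at this
      exact this
    · rintro _ ⟨x, hx, y, hy, rfl⟩
      exact ⟨x, trivial, y, hy, rfl⟩

end ClosedForms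

/-! ### The group law and the Lie bracket in a chart at the identity -/

section LocalProduct

variable (𝕜 : Type*) [NontriviallyNormedField 𝕜]
  {E : Type*} [NormedAddCommGroup E] [NormedSpace 𝕜 E]
  (G : Type*) [Group G] [TopologicalSpace G] [ChartedSpace E G]

/-- The product of a Lie group, read in the preferred chart at the identity. -/
def localMul (x y : E) : E :=
  chartAt E (1 : G) ((chartAt E (1 : G)).symm x * (chartAt E (1 : G)).symm y)

/-- The left-invariant vector field with value `v` at the identity, read in the preferred chart at
the identity. -/
def leftField (v x : E) : E :=
  fderiv 𝕜 (localMul G x) (chartAt E (1 : G) 1) v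

variable {G}

theorem chartAt_symm_one : (chartAt E (1 : G)).symm (chartAt E (1 : G) 1) = 1 :=
  (chartAt E (1 : G)).left_inv (mem_chart_source E 1)

theorem localMul_left_one {y : E} (hy : y ∈ (chartAt E (1 : G)).target) :
    localMul G (chartAt E (1 : G) 1) y = y := by
  rw [localMul, chartAt_symm_one, one_mul, (chartAt E (1 : G)).right_inv hy]

theorem localMul_right_one {x : E} (hx : x ∈ (chartAt E (1 : G)).target) :
    localMul G x (chartAt E (1 : G) 1) = x := by
  rw [localMul, chartAt_symm_one, mul_one, (chartAt E (1 : G)).right_inv hx]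

variable {𝕜}

theorem contMDiffAt_chartAt_symm [LieGroup 𝓘(𝕜, E) ∞ G] (g : G) :
    ContMDiffAt 𝓘(𝕜, E) 𝓘(𝕜, E) ∞ (chartAt E g).symm (chartAt E g g) :=
  (contMDiffOn_chart_symm (I := 𝓘(𝕜, E))).contMDiffAt
    ((chartAt E g).open_target.mem_nhds (mem_chart_target E g))

theorem contMDiffAt_chartAt [LieGroup 𝓘(𝕜, E) ∞ G] (g : G) :
    ContMDiffAt 𝓘(𝕜, E) 𝓘(𝕜, E) ∞ (chartAt E g) g :=
  (contMDiffOn_chart (I := 𝓘(𝕜, E))).contMDiffAt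
    ((chartAt E g).open_source.mem_nhds (mem_chart_source E g))

theorem contDiffAt_localMul [LieGroup 𝓘(𝕜, E) ∞ G] :
    ContDiffAt 𝕜 ∞ (fun z : E × E => localMul G z.1 z.2)
      (chartAt E (1 : G) 1, chartAt E (1 : G) 1) := by
  rw [← contMDiffAt_iff_contDiffAt]
  set x₀ := chartAt E (1 : G) 1 with hx₀
  have h1 : ContMDiffAt 𝓘(𝕜, E × E) 𝓘(𝕜, E) ∞
      (fun z : E × E => (chartAt E (1 : G)).symm z.1) (x₀, x₀) :=
    ContMDiffAt.comp (x₀, x₀) (contMDiffAt_chartAt_symm (1 : G))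
      contDiff_fst.contMDiff.contMDiffAt
  have h2 : ContMDiffAt 𝓘(𝕜, E × E) 𝓘(𝕜, E) ∞
      (fun z : E × E => (chartAt E (1 : G)).symm z.2) (x₀, x₀) :=
    ContMDiffAt.comp (x₀, x₀) (contMDiffAt_chartAt_symm (1 : G))
      contDiff_snd.contMDiff.contMDiffAt
  have h3 := h1.mul h2
  refine ContMDiffAt.comp_of_eq (contMDiffAt_chartAt (1 : G)) h3 ?_
  simp [hx₀]

theorem leftField_one (v : E) : leftField 𝕜 G v (chartAt E (1 : G) 1) = v := by
  have : localMul G (chartAt E (1 : G) 1) =ᶠ[𝓝 (chartAt E (1 : G) 1)] id :=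
    Filter.eventuallyEq_of_mem
      ((chartAt E (1 : G)).open_target.mem_nhds (mem_chart_target E 1)) fun y hy =>
        localMul_left_one hy
  rw [leftField, this.fderiv_eq, fderiv_id]
  rfl

/-- The differential of the product in the second variable. -/
theorem eventually_leftField_eq
    (hm : ContDiffAt 𝕜 ∞ (fun z : E × E => localMul G z.1 z.2)
      (chartAt E (1 : G) 1, chartAt E (1 : G) 1)) :
    ∀ᶠ x in 𝓝 (chartAt E (1 : G) 1), ∀ v, leftField 𝕜 G v x =
      fderiv 𝕜 (fun z : E × E => localMul G z.1 z.2) (x, chartAt E (1 : G) 1) (0, v) := by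
  have h : ∀ᶠ z in 𝓝 (chartAt E (1 : G) 1, chartAt E (1 : G) 1),
      DifferentiableAt 𝕜 (fun z : E × E => localMul G z.1 z.2) z :=
    (hm.of_le (m := 1) (by simp)).eventually (by simp)
      |>.mono fun z hz => hz.differentiableAt (by simp)
  have hc : ContinuousAt (fun x : E => (x, chartAt E (1 : G) 1)) (chartAt E (1 : G) 1) := by
    fun_prop
  filter_upwards [hc.eventually h] with x hx v
  have h2 := hx.hasFDerivAt.comp (chartAt E (1 : G) 1)
    (hasFDerivAt_prodMk_right (𝕜 := 𝕜) x (chartAt E (1 : G) 1))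
  exact congrArg (· v) h2.fderiv

/-- A left-invariant field is the partial derivative of the product in its second variable, so its
derivative is a mixed second derivative of the product. -/
theorem hasFDerivAt_leftField
    (hm : ContDiffAt 𝕜 ∞ (fun z : E × E => localMul G z.1 z.2)
      (chartAt E (1 : G) 1, chartAt E (1 : G) 1)) (v : E) :
    HasFDerivAt (leftField 𝕜 G v)
      (((fderiv 𝕜 (fderiv 𝕜 (fun z : E × E => localMul G z.1 z.2))
        (chartAt E (1 : G) 1, chartAt E (1 : G) 1)).flip (0, v)).comp
          (ContinuousLinearMap.inl 𝕜 E E)) (chartAt E (1 : G) 1) := by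
  have h1 : DifferentiableAt 𝕜 (fderiv 𝕜 (fun z : E × E => localMul G z.1 z.2))
      (chartAt E (1 : G) 1, chartAt E (1 : G) 1) :=
    (hm.fderiv_right (m := 1) (by norm_cast)).differentiableAt (by simp)
  have h2 := HasFDerivAt.comp (chartAt E (1 : G) 1) (f := fun x => (x, chartAt E (1 : G) 1))
    h1.hasFDerivAt
    (hasFDerivAt_prodMk_left (𝕜 := 𝕜) (chartAt E (1 : G) 1) (chartAt E (1 : G) 1))
  have h3 := h2.clm_apply (hasFDerivAt_const ((0, v) : E × E) (chartAt E (1 : G) 1))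
  refine (h3.congr_of_eventuallyEq ?_).congr_fderiv ?_
  · filter_upwards [eventually_leftField_eq hm] with x hx
    exact hx v
  · ext w
    simp

/-- In the preferred chart, `mulInvariantVectorField` is `leftField`. -/
theorem eventually_mpullback_eq_leftField [LieGroup 𝓘(𝕜, E) ∞ G] (v : E) :
    VectorField.mpullbackWithin 𝓘(𝕜, E) 𝓘(𝕜, E) (extChartAt 𝓘(𝕜, E) (1 : G)).symm
        (mulInvariantVectorField (I := 𝓘(𝕜, E)) (G := G) v) (Set.range 𝓘(𝕜, E))
      =ᶠ[𝓝 (chartAt E (1 : G) 1)] leftField 𝕜 G v := by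
  have : IsManifold 𝓘(𝕜, E) 1 G := IsManifold.of_le (n := ∞) (by simp)
  filter_upwards [(chartAt E (1 : G)).open_target.mem_nhds (mem_chart_target E 1)] with x hx
  have hx' : x ∈ (extChartAt 𝓘(𝕜, E) (1 : G)).target := by simpa using hx
  set g := (chartAt E (1 : G)).symm x with hg
  have hgs : g ∈ (chartAt E (1 : G)).source := (chartAt E (1 : G)).map_target hx
  rw [VectorField.mpullbackWithin_apply]
  have h1 := mfderiv_extChartAt_comp_mfderivWithin_extChartAt_symm (I := 𝓘(𝕜, E)) hx'
  have h2 := mfderivWithin_extChartAt_symm_comp_mfderiv_extChartAt (I := 𝓘(𝕜, E)) hx'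
  have h3 := ContinuousLinearMap.inverse_eq h2 h1
  rw [h3]
  have hA : MDifferentiableAt 𝓘(𝕜, E) 𝓘(𝕜, E) (fun h : G => g * h) 1 :=
    (contMDiff_mul_left (n := ∞)).contMDiffAt.mdifferentiableAt (by simp)
  have hB : MDifferentiableAt 𝓘(𝕜, E) 𝓘(𝕜, E) (extChartAt 𝓘(𝕜, E) (1 : G)) (g * 1) :=
    mdifferentiableAt_extChartAt (by rwa [mul_one])
  have h5 : (mfderiv 𝓘(𝕜, E) 𝓘(𝕜, E) ((extChartAt 𝓘(𝕜, E) (1 : G)) ∘ fun h : G => g * h) 1 :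
      E →L[𝕜] E) = fderiv 𝕜 (localMul G x) (chartAt E (1 : G) 1) := by
    refine (MDifferentiableAt.mfderiv (hB.comp _ hA)).trans ?_
    simp only [mfld_simps, fderivWithin_univ, writtenInExtChartAt]
    rfl
  have h6 : ∀ k : G, k = g → (mfderiv 𝓘(𝕜, E) 𝓘(𝕜, E) (extChartAt 𝓘(𝕜, E) (1 : G)) k :
      E →L[𝕜] E) = mfderiv 𝓘(𝕜, E) 𝓘(𝕜, E) (extChartAt 𝓘(𝕜, E) (1 : G)) g := by
    rintro _ rfl; rfl
  have h4 : (mfderiv 𝓘(𝕜, E) 𝓘(𝕜, E) ((extChartAt 𝓘(𝕜, E) (1 : G)) ∘ fun h : G => g * h) 1 :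
      E →L[𝕜] E) v = (mfderiv 𝓘(𝕜, E) 𝓘(𝕜, E) (extChartAt 𝓘(𝕜, E) (1 : G)) (g * 1) :
      E →L[𝕜] E) ((mfderiv 𝓘(𝕜, E) 𝓘(𝕜, E) (fun h : G => g * h) 1 : E →L[𝕜] E) v) :=
    congrArg (fun T : E →L[𝕜] E => T v) (mfderiv_comp (1 : G) hB hA)
  rw [leftField, ← h5]
  refine Eq.trans ?_ h4.symm
  exact congrArg (fun T : E →L[𝕜] E =>
    T ((mfderiv 𝓘(𝕜, E) 𝓘(𝕜, E) (fun h : G => g * h) 1 : E →L[𝕜] E) v)) (h6 _ (mul_one g)).symm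

theorem bracket_eq [LieGroup 𝓘(𝕜, E) ∞ G] (v w : E) :
    Bracket.bracket (L := GroupLieAlgebra 𝓘(𝕜, E) G) (M := GroupLieAlgebra 𝓘(𝕜, E) G) v w =
      (fderiv 𝕜 (leftField 𝕜 G w) (chartAt E (1 : G) 1) v -
        fderiv 𝕜 (leftField 𝕜 G v) (chartAt E (1 : G) 1) w : E) := by
  have hv := eventually_mpullback_eq_leftField (𝕜 := 𝕜) (G := G) v
  have hw := eventually_mpullback_eq_leftField (𝕜 := 𝕜) (G := G) w
  have h := Filter.EventuallyEq.lieBracketWithin_vectorField_eq_nhds (s := Set.univ) (𝕜 := 𝕜) hv hw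
  have h1 : ∀ T : E →L[𝕜] E, T = ContinuousLinearMap.id 𝕜 E → ∀ z, T.inverse z = z := by
    rintro _ rfl z
    rw [ContinuousLinearMap.inverse_id, ContinuousLinearMap.id_apply]
  refine (VectorField.mlieBracketWithin_apply (s := Set.univ)).trans
    ((h1 _ mfderiv_extChartAt_self _).trans ?_)
  simp only [mfld_simps] at h ⊢
  refine h.trans ?_
  rw [VectorField.lieBracketWithin, fderivWithin_univ, fderivWithin_univ, leftField_one,
    leftField_one]

end LocalProduct

/-! ### Real differentials compute the complex bracket -/

section RealBracket

variable {E : Type*} [NormedAddCommGroup E] [NormedSpace ℂ E]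
  {G : Type*} [Group G] [TopologicalSpace G] [ChartedSpace E G]


/-- The product is holomorphic near the identity, so its real and complex differentials agree there.
Equality on a neighbourhood is needed because the fields are differentiated once more. -/
theorem leftField_complex_eq_real [LieGroup 𝓘(ℂ, E) ∞ G] (v : E) :
    leftField ℂ G v =ᶠ[𝓝 (chartAt E (1 : G) 1)] leftField ℝ G v := by
  have h : ∀ᶠ z in 𝓝 (chartAt E (1 : G) 1, chartAt E (1 : G) 1),
      DifferentiableAt ℂ (fun z : E × E => localMul G z.1 z.2) z :=
    ((contDiffAt_localMul (𝕜 := ℂ) (G := G)).of_le (m := 1) (by simp)).eventually (by simp)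
      |>.mono fun z hz => hz.differentiableAt (by simp)
  have hc : ContinuousAt (fun x : E => (x, chartAt E (1 : G) 1)) (chartAt E (1 : G) 1) := by
    fun_prop
  filter_upwards [hc.eventually h] with x hx
  have h2 := hx.comp (chartAt E (1 : G) 1)
    (hasFDerivAt_prodMk_right (𝕜 := ℂ) x (chartAt E (1 : G) 1)).differentiableAt
  rw [leftField, leftField]
  exact congrArg (· v) (h2.fderiv_restrictScalars ℝ).symm

/-- The bracket in terms of the real differentials of the left-invariant vector fields. -/
theorem bracket_eq_real [LieGroup 𝓘(ℂ, E) ∞ G] (v w : E) :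
    Bracket.bracket (L := GroupLieAlgebra 𝓘(ℂ, E) G) (M := GroupLieAlgebra 𝓘(ℂ, E) G) v w =
      (fderiv ℝ (leftField ℝ G w) (chartAt E (1 : G) 1) v -
        fderiv ℝ (leftField ℝ G v) (chartAt E (1 : G) 1) w : E) := by
  have h : ∀ v w : E, fderiv ℝ (leftField ℝ G w) (chartAt E (1 : G) 1) v =
      fderiv ℂ (leftField ℂ G w) (chartAt E (1 : G) 1) v := by
    intro v w
    rw [← (leftField_complex_eq_real w).fderiv_eq,
      (hasFDerivAt_leftField (contDiffAt_localMul (𝕜 := ℂ))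
        w).differentiableAt.fderiv_restrictScalars ℝ]
    rfl
  rw [h, h]
  exact bracket_eq v w

theorem contDiffAt_localMul_real [LieGroup 𝓘(ℂ, E) ∞ G] :
    ContDiffAt ℝ ∞ (fun z : E × E => localMul G z.1 z.2)
      (chartAt E (1 : G) 1, chartAt E (1 : G) 1) :=
  (contDiffAt_localMul (𝕜 := ℂ)).restrict_scalars ℝ

end RealBracket

/-! ### The tangent space of a real Lie subgroup is a subalgebra -/

section RealSubgroup

variable {E : Type*} [NormedAddCommGroup E] [NormedSpace ℂ E]
  {E₀ : Type*} [NormedAddCommGroup E₀] [NormedSpace ℝ E₀]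
  {G : Type*} [Group G] [TopologicalSpace G] [ChartedSpace E G]
  (G₀ : Subgroup G) [ChartedSpace E₀ G₀]

variable (E E₀) in
/-- The inclusion of a subgroup, read in the preferred charts at the identity. -/
def localVal (x : E₀) : E :=
  chartAt E (1 : G) ((chartAt E₀ (1 : G₀)).symm x : G)

variable {G₀}

theorem localVal_one : localVal E E₀ G₀ (chartAt E₀ (1 : G₀) 1) = chartAt E (1 : G) 1 := by
  rw [localVal, chartAt_symm_one]
  rfl

theorem contDiffAt_localVal
    (h : ContMDiffAt 𝓘(ℝ, E₀) 𝓘(ℝ, E) ∞ (Subtype.val : G₀ → G) 1) :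
    ContDiffAt ℝ ∞ (localVal E E₀ G₀) (chartAt E₀ (1 : G₀) 1) := by
  have := (contMDiffAt_iff.1 h).2
  simp only [mfld_simps, contDiffWithinAt_univ] at this
  exact this

theorem mem_lieAlg_iff (h : ContMDiffAt 𝓘(ℝ, E₀) 𝓘(ℝ, E) ∞ (Subtype.val : G₀ → G) 1) (x : E) :
    x ∈ lieAlg E E₀ G₀ ↔ ∃ v, fderiv ℝ (localVal E E₀ G₀) (chartAt E₀ (1 : G₀) 1) v = x := by
  have h1 : (mfderiv 𝓘(ℝ, E₀) 𝓘(ℝ, E) (Subtype.val : G₀ → G) (1 : G₀) : E₀ →L[ℝ] E) =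
      fderiv ℝ (localVal E E₀ G₀) (chartAt E₀ (1 : G₀) 1) := by
    refine (MDifferentiableAt.mfderiv (h.mdifferentiableAt (by simp))).trans ?_
    simp only [mfld_simps, fderivWithin_univ, writtenInExtChartAt]
    rfl
  rw [← h1]
  exact Iff.rfl

theorem eventually_val_mem_source [LieGroup 𝓘(ℝ, E₀) ∞ G₀] (h : Continuous (Subtype.val : G₀ → G)) :
    ∀ᶠ x in 𝓝 (chartAt E₀ (1 : G₀) 1),
      (((chartAt E₀ (1 : G₀)).symm x : G₀) : G) ∈ (chartAt E (1 : G)).source := by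
  have h1 : ContinuousAt (fun x => (((chartAt E₀ (1 : G₀)).symm x : G₀) : G))
      (chartAt E₀ (1 : G₀) 1) :=
    h.continuousAt.comp ((chartAt E₀ (1 : G₀)).continuousAt_symm (mem_chart_target E₀ 1))
  refine h1.eventually ((chartAt E (1 : G)).open_source.mem_nhds ?_)
  simp only [chartAt_symm_one]
  exact mem_chart_source E (1 : G)

/-- The inclusion is a homomorphism; in charts this makes sense only near the identity, where the
factors and the product stay in the chart domains. -/
theorem localVal_localMul [LieGroup 𝓘(ℝ, E₀) ∞ G₀] :
    ∀ᶠ z in 𝓝 (chartAt E₀ (1 : G₀) 1, chartAt E₀ (1 : G₀) 1),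
      localVal E E₀ G₀ (localMul G₀ z.1 z.2) =
        localMul G (localVal E E₀ G₀ z.1) (localVal E E₀ G₀ z.2) := by
  have hs := eventually_val_mem_source (E := E) (E₀ := E₀) (G₀ := G₀) continuous_subtype_val
  have h1 : ∀ᶠ z in 𝓝 (chartAt E₀ (1 : G₀) 1, chartAt E₀ (1 : G₀) 1),
      (chartAt E₀ (1 : G₀)).symm z.1 * (chartAt E₀ (1 : G₀)).symm z.2 ∈
        (chartAt E₀ (1 : G₀)).source := by
    have : IsTopologicalGroup G₀ := topologicalGroup_of_lieGroup 𝓘(ℝ, E₀) ∞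
    have hc := (chartAt E₀ (1 : G₀)).continuousAt_symm (mem_chart_target E₀ 1)
    have hc' : ContinuousAt (fun z : E₀ × E₀ => (chartAt E₀ (1 : G₀)).symm z.1 *
        (chartAt E₀ (1 : G₀)).symm z.2) (chartAt E₀ (1 : G₀) 1, chartAt E₀ (1 : G₀) 1) :=
      (ContinuousAt.comp (g := (chartAt E₀ (1 : G₀)).symm) (f := Prod.fst) hc
        continuousAt_fst).mul
      (ContinuousAt.comp (g := (chartAt E₀ (1 : G₀)).symm) (f := Prod.snd) hc continuousAt_snd)
    refine hc'.eventually ((chartAt E₀ (1 : G₀)).open_source.mem_nhds ?_)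
    simp
  filter_upwards [h1, continuousAt_fst.eventually hs, continuousAt_snd.eventually hs]
    with z hz h2 h3
  rw [localVal, localMul, (chartAt E₀ (1 : G₀)).left_inv hz, localMul, localVal, localVal,
    (chartAt E (1 : G)).left_inv h2, (chartAt E (1 : G)).left_inv h3]
  rfl

/-- The inclusion of a subgroup relates left-invariant vector fields. -/
theorem fderiv_localVal_leftField [LieGroup 𝓘(ℂ, E) ∞ G] [LieGroup 𝓘(ℝ, E₀) ∞ G₀]
    (h : ContMDiffAt 𝓘(ℝ, E₀) 𝓘(ℝ, E) ∞ (Subtype.val : G₀ → G) 1) (w : E₀) :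
    ∀ᶠ x in 𝓝 (chartAt E₀ (1 : G₀) 1),
      fderiv ℝ (localVal E E₀ G₀) x (leftField ℝ G₀ w x) =
        leftField ℝ G (fderiv ℝ (localVal E E₀ G₀) (chartAt E₀ (1 : G₀) 1) w)
          (localVal E E₀ G₀ x) := by
  set y₀ := chartAt E₀ (1 : G₀) 1 with hy₀
  have hi := contDiffAt_localVal h
  have hm := contDiffAt_localMul_real (E := E) (G := G)
  have hm0 := contDiffAt_localMul (𝕜 := ℝ) (E := E₀) (G := G₀)
  have hi1 : ∀ᶠ x in 𝓝 y₀, DifferentiableAt ℝ (localVal E E₀ G₀) x :=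
    (hi.of_le (m := 1) (by simp)).eventually (by simp) |>.mono
      fun z hz => hz.differentiableAt (by simp)
  have hm1 : ∀ᶠ z in 𝓝 (chartAt E (1 : G) 1, chartAt E (1 : G) 1),
      DifferentiableAt ℝ (fun z : E × E => localMul G z.1 z.2) z :=
    (hm.of_le (m := 1) (by simp)).eventually (by simp) |>.mono
      fun z hz => hz.differentiableAt (by simp)
  have hm01 : ∀ᶠ z in 𝓝 (y₀, y₀),
      DifferentiableAt ℝ (fun z : E₀ × E₀ => localMul G₀ z.1 z.2) z :=
    (hm0.of_le (m := 1) (by simp)).eventually (by simp) |>.mono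
      fun z hz => hz.differentiableAt (by simp)
  have hc : ContinuousAt (fun x : E₀ => (x, y₀)) y₀ := by fun_prop
  have hc' : Filter.Tendsto (fun x : E₀ => (localVal E E₀ G₀ x, chartAt E (1 : G) 1)) (𝓝 y₀)
      (𝓝 (chartAt E (1 : G) 1, chartAt E (1 : G) 1)) := by
    refine Filter.Tendsto.prodMk_nhds ?_ tendsto_const_nhds
    have := hi.continuousAt
    rwa [ContinuousAt, localVal_one] at this
  filter_upwards [hc.eventually (localVal_localMul (E := E)).eventually_nhds, hc.eventually hm01,
    hc'.eventually hm1, hi1, (chartAt E₀ (1 : G₀)).open_target.mem_nhds (mem_chart_target E₀ 1)]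
    with x hx1 hx2 hx3 hx4 hx5
  have hr : localMul G₀ x y₀ = x := localMul_right_one hx5
  have e1 : HasFDerivAt (localMul G₀ x) (fderiv ℝ (localMul G₀ x) y₀) y₀ :=
    (hx2.comp y₀ (hasFDerivAt_prodMk_right (𝕜 := ℝ) x y₀).differentiableAt).hasFDerivAt
  have e2 : HasFDerivAt (localMul G (localVal E E₀ G₀ x))
      (fderiv ℝ (localMul G (localVal E E₀ G₀ x)) (chartAt E (1 : G) 1)) (localVal E E₀ G₀ y₀) := by
    rw [localVal_one]
    exact (hx3.comp (chartAt E (1 : G) 1)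
      (hasFDerivAt_prodMk_right (𝕜 := ℝ) _ _).differentiableAt).hasFDerivAt
  have e3 : HasFDerivAt (localVal E E₀ G₀) (fderiv ℝ (localVal E E₀ G₀) x)
      (localMul G₀ x y₀) := by
    rw [hr]; exact hx4.hasFDerivAt
  have e4 : (fun y => localVal E E₀ G₀ (localMul G₀ x y)) =ᶠ[𝓝 y₀]
      fun y => localMul G (localVal E E₀ G₀ x) (localVal E E₀ G₀ y) :=
    (show ContinuousAt (fun y : E₀ => (x, y)) y₀ by fun_prop).eventually hx1
  have e5 := (e3.comp y₀ e1).fderiv.symm.trans (e4.fderiv_eq.trans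
    (e2.comp y₀ (hi.differentiableAt (by simp)).hasFDerivAt).fderiv)
  exact congrArg (· w) e5

/-- The Lie algebra of a real Lie subgroup is closed under the bracket. -/
theorem lie_mem_lieAlg [LieGroup 𝓘(ℂ, E) ∞ G] [LieGroup 𝓘(ℝ, E₀) ∞ G₀]
    (h : ContMDiffAt 𝓘(ℝ, E₀) 𝓘(ℝ, E) ∞ (Subtype.val : G₀ → G) 1)
    (a : GroupLieAlgebra 𝓘(ℂ, E) G) (ha : a ∈ lieAlg E E₀ G₀)
    (b : GroupLieAlgebra 𝓘(ℂ, E) G) (hb : b ∈ lieAlg E E₀ G₀) :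
    ⁅a, b⁆ ∈ lieAlg E E₀ G₀ := by
  obtain ⟨v, rfl⟩ := (mem_lieAlg_iff h a).1 ha
  obtain ⟨w, rfl⟩ := (mem_lieAlg_iff h b).1 hb
  set y₀ := chartAt E₀ (1 : G₀) 1 with hy₀
  set D := fderiv ℝ (localVal E E₀ G₀) y₀ with hD
  have hi := contDiffAt_localVal h
  -- Differentiate the relation between left-invariant fields. The second derivative of the
  -- inclusion is symmetric, so it cancels in the bracket and leaves a vector in the image of `D`.
  have key : ∀ v w : E₀, fderiv ℝ (leftField ℝ G (D w)) (chartAt E (1 : G) 1) (D v) =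
      fderiv ℝ (fderiv ℝ (localVal E E₀ G₀)) y₀ v w +
        D (fderiv ℝ (leftField ℝ G₀ w) y₀ v) := by
    intro v w
    have e1 : DifferentiableAt ℝ (fderiv ℝ (localVal E E₀ G₀)) y₀ :=
      (hi.fderiv_right (m := 1) (by norm_cast)).differentiableAt (by simp)
    have e2 := (hasFDerivAt_leftField (contDiffAt_localMul (𝕜 := ℝ) (G := G₀))
      w).differentiableAt.hasFDerivAt
    have e3 := e1.hasFDerivAt.clm_apply e2
    have e4 : HasFDerivAt (leftField ℝ G (D w))
        (fderiv ℝ (leftField ℝ G (D w)) (chartAt E (1 : G) 1)) (localVal E E₀ G₀ y₀) := by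
      rw [localVal_one]
      exact (((hasFDerivAt_leftField (contDiffAt_localMul (𝕜 := ℂ))
        (D w)).differentiableAt.restrictScalars
        ℝ).congr_of_eventuallyEq (leftField_complex_eq_real (D w)).symm).hasFDerivAt
    have e5 := (e4.comp y₀ (hi.differentiableAt (by simp)).hasFDerivAt).fderiv.symm.trans
      ((Filter.EventuallyEq.fderiv_eq (fderiv_localVal_leftField h w)).symm.trans e3.fderiv)
    have e6 := congrArg (· v) e5
    rw [← hy₀] at e6
    simpa [leftField_one, hy₀, add_comm] using e6
  have hsymm : fderiv ℝ (fderiv ℝ (localVal E E₀ G₀)) y₀ v w =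
      fderiv ℝ (fderiv ℝ (localVal E E₀ G₀)) y₀ w v :=
    (hi.isSymmSndFDerivAt (by simp; norm_cast)) v w
  have hb := bracket_eq_real (G := G) (D v) (D w)
  rw [key, key, hsymm, add_sub_add_left_eq_sub, ← map_sub] at hb
  exact (mem_lieAlg_iff h _).2 ⟨_, hb.symm⟩

end RealSubgroup

/-! ### Calculus of 2-forms on a vector space -/

section TwoForms

variable {E : Type*} [NormedAddCommGroup E] [NormedSpace ℝ E]

theorem twoForm_swap (f : E [⋀^Fin 2]→L[ℝ] ℝ) (u v : E) : f ![v, u] = -f ![u, v] := by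
  refine Eq.trans ?_ (f.toAlternatingMap.map_swap ![u, v] (i := 0) (j := 1) (by decide))
  refine congrArg f ?_
  ext i
  fin_cases i <;> rfl

theorem twoForm_sub (f : E [⋀^Fin 2]→L[ℝ] ℝ) (u u' v : E) :
    f ![u - u', v] = f ![u, v] - f ![u', v] := by
  have h1 := f.toMultilinearMap.cons_add ![v] (u - u') u'
  rw [sub_add_cancel] at h1
  exact eq_sub_of_add_eq h1.symm

theorem extDeriv_twoForm_apply (σ : E → E [⋀^Fin 2]→L[ℝ] ℝ) (x a b c : E) :
    extDeriv σ x ![a, b, c] =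
      fderiv ℝ σ x a ![b, c] - fderiv ℝ σ x b ![a, c] + fderiv ℝ σ x c ![a, b] := by
  have r0 : Fin.removeNth (0 : Fin 3) ![a, b, c] = ![b, c] := by
    ext i; fin_cases i <;> rfl
  have r1 : Fin.removeNth (1 : Fin 3) ![a, b, c] = ![a, c] := by
    ext i; fin_cases i <;> rfl
  have r2 : Fin.removeNth (2 : Fin 3) ![a, b, c] = ![a, b] := by
    ext i; fin_cases i <;> rfl
  rw [extDeriv, ContinuousAlternatingMap.alternatizeUncurryFin_apply]
  refine (Fin.sum_univ_three _).trans ?_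
  rw [r0, r1, r2]
  simp [sub_eq_add_neg]

/-- The product rule at a point where the pulling-back map is the identity: one term for the form
and one for each slot. -/
theorem hasFDerivAt_twoForm_comp {σ : E → E [⋀^Fin 2]→L[ℝ] ℝ} {A : E → E →L[ℝ] E}
    {σ' : E →L[ℝ] E [⋀^Fin 2]→L[ℝ] ℝ} {A' : E →L[ℝ] E →L[ℝ] E} {x : E} (hσ : HasFDerivAt σ σ' x)
    (hA : HasFDerivAt A A' x) (hA0 : A x = ContinuousLinearMap.id ℝ E) :
    ∃ D : E →L[ℝ] E [⋀^Fin 2]→L[ℝ] ℝ,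
      HasFDerivAt (fun y => (σ y).compContinuousLinearMap (A y)) D x ∧
      ∀ c a b, D c ![a, b] = σ' c ![a, b] + σ x ![A' c a, b] + σ x ![a, A' c b] := by
  refine ⟨_, hσ.continuousAlternatingMapCompContinuousLinearMap hA, fun c a b => ?_⟩
  rw [hA0]
  simp only [add_apply, ContinuousLinearMap.comp_apply,
    ContinuousAlternatingMap.add_apply,
    ContinuousAlternatingMap.fderivCompContinuousLinearMap_apply, Fin.sum_univ_two, add_assoc]
  refine congrArg₂ (· + ·) rfl (congrArg₂ (· + ·) (congrArg (σ x) ?_) (congrArg (σ x) ?_)) <;>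
  · ext i
    fin_cases i <;> rfl

end TwoForms

/-! ### Right translates of a form and their derivatives -/

section TranslatedForms

variable {E : Type*} [NormedAddCommGroup E] [NormedSpace ℂ E]
  {G : Type*} [Group G] [TopologicalSpace G] [ChartedSpace E G]
  {N : Type*} [TopologicalSpace N] [ChartedSpace E N]

/-- The pullback of a form `η` on `N` under `x ↦ p (x * g)`, evaluated at the identity. -/
def transForm (p : G → N) (η : TwoForm E N) (g : G) : E [⋀^Fin 2]→L[ℝ] ℝ :=
  (η (p (1 * g)) : E [⋀^Fin 2]→L[ℝ] ℝ).compContinuousLinearMap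
    ((mfderiv 𝓘(ℂ, E) 𝓘(ℂ, E) (fun x => p (x * g)) 1 : E →L[ℂ] E).restrictScalars ℝ)

/-- The map `x ↦ p (x * k)` read in charts. -/
def transMap (p : G → N) (q : N) (k : G) (x : E) : E :=
  chartAt E q (p ((chartAt E (1 : G)).symm x * k))

variable {p : G → N} {η : TwoForm E N} {U : Set N}

theorem transMap_one {q : N} {k : G} :
    transMap p q k (chartAt E (1 : G) 1) = chartAt E q (p k) := by
  rw [transMap, chartAt_symm_one, one_mul]

section

variable [LieGroup 𝓘(ℂ, E) ∞ G] [IsManifold 𝓘(ℂ, E) ∞ N]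

/-- Joint smoothness in the point and the translating element makes the differential at the identity
depend smoothly on that element. -/
theorem contDiffAt_transMap₂ (hp : ContMDiff 𝓘(ℂ, E) 𝓘(ℂ, E) ∞ p) (g : G) :
    ContDiffAt ℂ ∞ (fun z : E × E => transMap p (p g) ((chartAt E g).symm z.2) z.1)
      (chartAt E (1 : G) 1, chartAt E g g) := by
  rw [← contMDiffAt_iff_contDiffAt]
  set z₀ := (chartAt E (1 : G) 1, chartAt E g g) with hz₀
  have h1 : ContMDiffAt 𝓘(ℂ, E × E) 𝓘(ℂ, E) ∞
      (fun z : E × E => (chartAt E (1 : G)).symm z.1) z₀ :=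
    ContMDiffAt.comp z₀ (contMDiffAt_chartAt_symm (1 : G))
      contDiff_fst.contMDiff.contMDiffAt
  have h2 : ContMDiffAt 𝓘(ℂ, E × E) 𝓘(ℂ, E) ∞
      (fun z : E × E => (chartAt E g).symm z.2) z₀ :=
    ContMDiffAt.comp z₀ (contMDiffAt_chartAt_symm g)
      contDiff_snd.contMDiff.contMDiffAt
  have h3 := hp.contMDiffAt.comp z₀ (h1.mul h2)
  have h4 : ContMDiffAt 𝓘(ℂ, E) 𝓘(ℂ, E) ∞ (chartAt E (p g)) (p g) :=
    (contMDiffOn_chart (I := 𝓘(ℂ, E))).contMDiffAt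
      ((chartAt E (p g)).open_source.mem_nhds (mem_chart_source E _))
  refine ContMDiffAt.comp_of_eq h4 h3 ?_
  simp [hz₀]

theorem contDiffAt_transMap (hp : ContMDiff 𝓘(ℂ, E) 𝓘(ℂ, E) ∞ p) {q : N} {k : G}
    (hk : p k ∈ (chartAt E q).source) :
    ContDiffAt ℂ ∞ (transMap p q k) (chartAt E (1 : G) 1) := by
  rw [← contMDiffAt_iff_contDiffAt]
  have h2 : ContMDiffAt 𝓘(ℂ, E) 𝓘(ℂ, E) ∞ (fun x : G => x * k) 1 :=
    contMDiff_mul_right.contMDiffAt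
  have h3 := hp.contMDiffAt.comp (1 : G) h2
  have h5 := ContMDiffAt.comp_of_eq h3 (contMDiffAt_chartAt_symm (1 : G)) (chartAt_symm_one)
  have h4 : ContMDiffAt 𝓘(ℂ, E) 𝓘(ℂ, E) ∞ (chartAt E q) (p k) :=
    (contMDiffOn_chart (I := 𝓘(ℂ, E))).contMDiffAt
      ((chartAt E q).open_source.mem_nhds hk)
  refine ContMDiffAt.comp_of_eq h4 h5 ?_
  simp

/-- `transForm` in terms of the expression of the form in a chart. -/
theorem transForm_eq_inChart (hp : ContMDiff 𝓘(ℂ, E) 𝓘(ℂ, E) ∞ p) {q : N} {k : G}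
    (hk : p k ∈ (chartAt E q).source) :
    transForm p η k = (η.inChart (chartAt E q)
      (transMap p q k (chartAt E (1 : G) 1))).compContinuousLinearMap
        (fderiv ℝ (transMap p q k) (chartAt E (1 : G) 1)) := by
  have hθ := contDiffAt_transMap hp hk
  have hθd : DifferentiableAt ℂ (transMap p q k) (chartAt E (1 : G) 1) :=
    hθ.differentiableAt (by simp)
  set y := transMap p q k (chartAt E (1 : G) 1) with hy
  have hye : (chartAt E q).symm y = p (1 * k) := by
    rw [hy, transMap_one, (chartAt E q).left_inv hk, one_mul]
  have hyt : y ∈ (chartAt E q).target := by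
    rw [hy, transMap_one]
    exact (chartAt E q).map_source hk
  have h0 : ∀ n n' : N, n = n' → ∀ T T' : E →L[ℝ] E, T = T' →
      (η n : E [⋀^Fin 2]→L[ℝ] ℝ).compContinuousLinearMap T =
        (η n' : E [⋀^Fin 2]→L[ℝ] ℝ).compContinuousLinearMap T' := by
    rintro n _ rfl T _ rfl; rfl
  have hM : IsManifold 𝓘(ℂ, E) 1 N := IsManifold.of_le (n := ∞) (by simp)
  have hM' : IsManifold 𝓘(ℂ, E) 1 G := IsManifold.of_le (n := ∞) (by simp)
  have hA : MDifferentiableAt 𝓘(ℂ, E) 𝓘(ℂ, E) (chartAt E q).symm y :=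
    mdifferentiableAt_atlas_symm (chart_mem_atlas E q) hyt
  have hB : MDifferentiableAt 𝓘(ℂ, E) 𝓘(ℂ, E) (transMap p q k ∘ chartAt E (1 : G)) 1 :=
    hθd.mdifferentiableAt.comp (1 : G)
      (mdifferentiableAt_atlas (chart_mem_atlas E (1 : G)) (mem_chart_source E 1))
  have hB' : (mfderiv 𝓘(ℂ, E) 𝓘(ℂ, E) (transMap p q k ∘ chartAt E (1 : G)) 1 : E →L[ℂ] E) =
      fderiv ℂ (transMap p q k) (chartAt E (1 : G) 1) := by
    refine (MDifferentiableAt.mfderiv hB).trans ?_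
    simp only [mfld_simps, fderivWithin_univ, writtenInExtChartAt]
    refine Filter.EventuallyEq.fderiv_eq ?_
    filter_upwards [(chartAt E (1 : G)).open_target.mem_nhds (mem_chart_target E 1)] with x hx
    simp only [Function.comp_apply, (chartAt E (1 : G)).right_inv hx]
    rfl
  have hev : (fun x => p (x * k)) =ᶠ[𝓝 1]
      (chartAt E q).symm ∘ (transMap p q k ∘ chartAt E (1 : G)) := by
    have hc : ContinuousAt (fun x => p (x * k)) 1 :=
      (hp.continuous.comp ((contMDiff_mul_right (I := 𝓘(ℂ, E)) (n := ∞)).continuous)).continuousAt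
    have hk' : p (1 * k) ∈ (chartAt E q).source := by rwa [one_mul]
    filter_upwards [(chartAt E (1 : G)).open_source.mem_nhds (mem_chart_source E 1),
      hc.eventually ((chartAt E q).open_source.mem_nhds hk')] with x hx hx'
    simp only [Function.comp_apply, transMap]
    rw [(chartAt E (1 : G)).left_inv hx, (chartAt E q).left_inv hx']
  let T : E →L[ℂ] E := mfderiv 𝓘(ℂ, E) 𝓘(ℂ, E) (chartAt E q).symm y
  have h1 : (mfderiv 𝓘(ℂ, E) 𝓘(ℂ, E) (fun x => p (x * k)) 1 : E →L[ℂ] E) =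
      T.comp
        (fderiv ℂ (transMap p q k) (chartAt E (1 : G) 1)) := by
    have h2 : (mfderiv 𝓘(ℂ, E) 𝓘(ℂ, E)
        ((chartAt E q).symm ∘ (transMap p q k ∘ chartAt E (1 : G))) 1 : E →L[ℂ] E) =
        T.comp
          (mfderiv 𝓘(ℂ, E) 𝓘(ℂ, E) (transMap p q k ∘ chartAt E (1 : G)) 1 : E →L[ℂ] E) :=
      mfderiv_comp (1 : G) hA hB
    rw [hB'] at h2
    exact hev.mfderiv_eq.trans h2
  have h3 : (mfderiv 𝓘(ℂ, E) 𝓘(ℂ, E) (fun x => p (x * k)) 1 : E →L[ℂ] E).restrictScalars ℝ =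
      (T.restrictScalars ℝ).comp
        (fderiv ℝ (transMap p q k) (chartAt E (1 : G) 1)) := by
    rw [h1, hθd.fderiv_restrictScalars ℝ]
    rfl
  exact h0 _ _ hye.symm _ _ h3

theorem inChart_contDiffAt (hη : IsKahlerFormOn η U) (hU : IsOpen U) {q : N} (hq : q ∈ U) :
    ContDiffAt ℝ ∞ (η.inChart (chartAt E q)) (chartAt E q q) := by
  refine (hη.smooth _ (chart_mem_atlas E q)).contDiffAt ?_
  refine ((chartAt E q).isOpen_inter_preimage_symm hU).mem_nhds ⟨mem_chart_target E q, ?_⟩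
  simpa using hq

/-- Strict differentiability serves the estimates that are uniform in the base point. -/
theorem hasStrictFDerivAt_transForm (hp : ContMDiff 𝓘(ℂ, E) 𝓘(ℂ, E) ∞ p)
    (hη : IsKahlerFormOn η U) (hU : IsOpen U) {g : G} (hg : p g ∈ U) :
    ∃ D : E →L[ℝ] E [⋀^Fin 2]→L[ℝ] ℝ,
      HasStrictFDerivAt (fun z => transForm p η ((chartAt E g).symm z)) D (chartAt E g g) := by
  set Φ : E × E → E := fun z => transMap p (p g) ((chartAt E g).symm z.2) z.1 with hΦ
  set x₀ := chartAt E (1 : G) 1 with hx₀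
  set z₀ := chartAt E g g with hz₀
  have hΦc : ContDiffAt ℝ ∞ Φ (x₀, z₀) := (contDiffAt_transMap₂ hp g).restrict_scalars ℝ
  have hΦ0 : Φ (x₀, z₀) = chartAt E (p g) (p g) := by
    simp only [hΦ, hx₀, hz₀, transMap_one]
    rw [(chartAt E g).left_inv (mem_chart_source E g)]
  have h1 : HasStrictFDerivAt (fun z : E => (x₀, z)) (ContinuousLinearMap.inr ℝ E E) z₀ :=
    (hasStrictFDerivAt_const x₀ z₀).prodMk (hasStrictFDerivAt_id z₀)
  have h2 : HasStrictFDerivAt (η.inChart (chartAt E (p g)))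
      (fderiv ℝ (η.inChart (chartAt E (p g))) (Φ (x₀, z₀))) (Φ (x₀, z₀)) := by
    rw [hΦ0]
    exact (inChart_contDiffAt hη hU hg).hasStrictFDerivAt (by simp)
  have h3 := h2.comp z₀ ((hΦc.hasStrictFDerivAt (by simp)).comp z₀ h1)
  have h4 : HasStrictFDerivAt (fderiv ℝ Φ) (fderiv ℝ (fderiv ℝ Φ) (x₀, z₀)) (x₀, z₀) :=
    (hΦc.fderiv_right (m := 1) (by norm_cast)).hasStrictFDerivAt (by simp)
  have h5 := (h4.comp z₀ h1).clm_comp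
    (hasStrictFDerivAt_const (ContinuousLinearMap.inl ℝ E E) z₀)
  have h6 := h3.continuousAlternatingMapCompContinuousLinearMap h5
  refine ⟨_, h6.congr_of_eventuallyEq ?_⟩
  have hc : ContinuousAt (fun z => p ((chartAt E g).symm z)) z₀ :=
    hp.continuous.continuousAt.comp ((chartAt E g).continuousAt_symm (mem_chart_target E g))
  have hs : p ((chartAt E g).symm z₀) ∈ (chartAt E (p g)).source := by
    rw [hz₀, (chartAt E g).left_inv (mem_chart_source E g)]
    exact mem_chart_source E _
  have hd : ∀ᶠ z in 𝓝 (x₀, z₀), DifferentiableAt ℝ Φ z :=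
    (hΦc.of_le (m := 1) (by simp)).eventually (by simp) |>.mono
      fun z hz => hz.differentiableAt (by simp)
  filter_upwards [hc.eventually ((chartAt E (p g)).open_source.mem_nhds hs),
    h1.continuousAt.eventually hd] with z hz hz'
  rw [transForm_eq_inChart hp hz]
  have h7 := hz'.hasFDerivAt.comp x₀ (f := fun x => (x, z)) (hasFDerivAt_prodMk_left x₀ z)
  rw [show fderiv ℝ (transMap p (p g) ((chartAt E g).symm z)) x₀ = _ from h7.fderiv]

theorem continuousAt_transForm (hp : ContMDiff 𝓘(ℂ, E) 𝓘(ℂ, E) ∞ p)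
    (hη : IsKahlerFormOn η U) (hU : IsOpen U) {g : G} (hg : p g ∈ U) :
    ContinuousAt (transForm p η) g := by
  obtain ⟨D, hD⟩ := hasStrictFDerivAt_transForm hp hη hU hg
  have h1 := hD.continuousAt.comp ((chartAt E g).continuousAt (mem_chart_source E g))
  refine h1.congr ?_
  filter_upwards [(chartAt E g).open_source.mem_nhds (mem_chart_source E g)] with x hx
  simp only [Function.comp_apply, (chartAt E g).left_inv hx]

/-- This is Cartan's formula for a closed form on right-invariant fields. The translate by `yg` is
the form `σ`, the pullback under `x ↦ p(xg)`, evaluated at `y` on the right-invariant fields `A y`.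
In the cyclic sum the derivatives of `σ` cancel by closedness, and those of `A` combine into
brackets. -/
theorem exists_hasFDerivAt_transForm_mul (hp : ContMDiff 𝓘(ℂ, E) 𝓘(ℂ, E) ∞ p)
    (hη : IsKahlerFormOn η U) (hU : IsOpen U) {g : G} (hg : p g ∈ U) :
    ∃ D : E →L[ℝ] E [⋀^Fin 2]→L[ℝ] ℝ,
      HasFDerivAt (fun y => transForm p η ((chartAt E (1 : G)).symm y * g)) D
        (chartAt E (1 : G) 1) ∧
      ∀ a b c : E, D c ![a, b] + D a ![b, c] + D b ![c, a] =
        transForm p η g ![Bracket.bracket (L := GroupLieAlgebra 𝓘(ℂ, E) G)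
          (M := GroupLieAlgebra 𝓘(ℂ, E) G) a c, b] +
        transForm p η g ![Bracket.bracket (L := GroupLieAlgebra 𝓘(ℂ, E) G)
          (M := GroupLieAlgebra 𝓘(ℂ, E) G) b a, c] +
        transForm p η g ![Bracket.bracket (L := GroupLieAlgebra 𝓘(ℂ, E) G)
          (M := GroupLieAlgebra 𝓘(ℂ, E) G) c b, a] := by
  set x₀ := chartAt E (1 : G) 1 with hx₀
  obtain ⟨q, hq⟩ : ∃ q, q = p g := ⟨_, rfl⟩
  rw [← hq] at hg
  set θ : E → E := transMap p q g with hθ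
  have hgq : p g ∈ (chartAt E q).source := hq ▸ mem_chart_source E q
  have hθc : ContDiffAt ℝ ∞ θ x₀ := (contDiffAt_transMap hp hgq).restrict_scalars ℝ
  have hθ0 : θ x₀ = chartAt E q q := transMap_one.trans (by rw [hq])
  have hηc : ContDiffAt ℝ ∞ (η.inChart (chartAt E q)) (θ x₀) := by
    rw [hθ0]
    exact inChart_contDiffAt hη hU hg
  have hηd : DifferentiableAt ℝ (η.inChart (chartAt E q)) (θ x₀) := hηc.differentiableAt (by simp)
  let σ : E → E [⋀^Fin 2]→L[ℝ] ℝ := fun y =>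
    (η.inChart (chartAt E q) (θ y)).compContinuousLinearMap (fderiv ℝ θ y)
  have hθ1 : DifferentiableAt ℝ (fderiv ℝ θ) x₀ :=
    (hθc.fderiv_right (m := 1) (by norm_cast)).differentiableAt (by simp)
  have hσd : HasFDerivAt σ (fderiv ℝ σ x₀) x₀ :=
    ((hηd.hasFDerivAt.comp x₀
      (hθc.differentiableAt (by simp)).hasFDerivAt).continuousAlternatingMapCompContinuousLinearMap
        hθ1.hasFDerivAt).differentiableAt.hasFDerivAt
  have hσ0 : extDeriv σ x₀ = 0 := by
    have h1 := extDeriv_pullback hηd hθc (by simp; norm_cast)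
    have h0 := hη.closed (chartAt E q) (chart_mem_atlas E q) (chartAt E q q)
      ⟨mem_chart_target E q, by simpa using hg⟩
    rw [hθ0, h0] at h1
    exact h1.trans (by ext; simp)
  have hcl : ∀ a b c : E, fderiv ℝ σ x₀ a ![b, c] - fderiv ℝ σ x₀ b ![a, c] +
      fderiv ℝ σ x₀ c ![a, b] = 0 := by
    intro a b c
    rw [← extDeriv_twoForm_apply, hσ0]
    rfl
  let M : E × E → E := fun z => localMul G z.1 z.2
  have hM : ContDiffAt ℝ ∞ M (x₀, x₀) := contDiffAt_localMul_real
  let A : E → E →L[ℝ] E := fun y => (fderiv ℝ M (x₀, y)).comp (ContinuousLinearMap.inl ℝ E E)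
  have hM1 : HasFDerivAt (fderiv ℝ M) (fderiv ℝ (fderiv ℝ M) (x₀, x₀)) (x₀, x₀) :=
    ((hM.fderiv_right (m := 1) (by norm_cast)).differentiableAt (by simp)).hasFDerivAt
  obtain ⟨A', hA, hA'⟩ : ∃ A' : E →L[ℝ] E →L[ℝ] E, HasFDerivAt A A' x₀ ∧
      ∀ c a, A' c a = fderiv ℝ (fderiv ℝ M) (x₀, x₀) (0, c) (a, 0) :=
    ⟨_, (hM1.comp x₀ (f := fun y => (x₀, y))
      (hasFDerivAt_prodMk_right (𝕜 := ℝ) x₀ x₀)).clm_comp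
        (hasFDerivAt_const (ContinuousLinearMap.inl ℝ E E) x₀), fun c a => by simp⟩
  have hMd : ∀ᶠ z in 𝓝 (x₀, x₀), DifferentiableAt ℝ M z :=
    (hM.of_le (m := 1) (by simp)).eventually (by simp) |>.mono
      fun z hz => hz.differentiableAt (by simp)
  have hA0 : A x₀ = ContinuousLinearMap.id ℝ E := by
    have h1 := hMd.self_of_nhds.hasFDerivAt.comp x₀ (f := fun x => (x, x₀))
      (hasFDerivAt_prodMk_left x₀ x₀)
    refine h1.fderiv.symm.trans (Eq.trans (Filter.EventuallyEq.fderiv_eq ?_) fderiv_id)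
    filter_upwards [(chartAt E (1 : G)).open_target.mem_nhds (mem_chart_target E 1)] with x hx
    exact localMul_right_one hx
  obtain ⟨D, hD, hD'⟩ := hasFDerivAt_twoForm_comp hσd hA hA0
  refine ⟨D, hD.congr_of_eventuallyEq ?_, ?_⟩
  · have hc1 : ContinuousAt (fun y => p ((chartAt E (1 : G)).symm y * g)) x₀ :=
      (hp.continuous.comp
        ((contMDiff_mul_right (I := 𝓘(ℂ, E)) (n := ∞) (a := g)).continuous)).continuousAt.comp
          ((chartAt E (1 : G)).continuousAt_symm (mem_chart_target E 1))
    have hs1 : p ((chartAt E (1 : G)).symm x₀ * g) ∈ (chartAt E q).source := by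
      rwa [hx₀, chartAt_symm_one, one_mul]
    have hc2 : ∀ᶠ z in 𝓝 (x₀, x₀), (chartAt E (1 : G)).symm z.1 * (chartAt E (1 : G)).symm z.2 ∈
        (chartAt E (1 : G)).source := by
      have : IsTopologicalGroup G := topologicalGroup_of_lieGroup 𝓘(ℂ, E) ∞
      have hc := (chartAt E (1 : G)).continuousAt_symm (mem_chart_target E 1)
      have hc' : ContinuousAt (fun z : E × E => (chartAt E (1 : G)).symm z.1 *
          (chartAt E (1 : G)).symm z.2) (x₀, x₀) :=
        (ContinuousAt.comp (g := (chartAt E (1 : G)).symm) (f := Prod.fst) hc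
          continuousAt_fst).mul
        (ContinuousAt.comp (g := (chartAt E (1 : G)).symm) (f := Prod.snd) hc continuousAt_snd)
      refine hc'.eventually ((chartAt E (1 : G)).open_source.mem_nhds ?_)
      simp [hx₀]
    have hθd : ∀ᶠ y in 𝓝 x₀, DifferentiableAt ℝ θ y :=
      (hθc.of_le (m := 1) (by simp)).eventually (by simp) |>.mono
        fun z hz => hz.differentiableAt (by simp)
    have hcr : ContinuousAt (fun y : E => (x₀, y)) x₀ := by fun_prop
    filter_upwards [hc1.eventually ((chartAt E q).open_source.mem_nhds hs1), hθd,
      hcr.eventually hc2.eventually_nhds, hcr.eventually hMd,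
      (chartAt E (1 : G)).open_target.mem_nhds (mem_chart_target E 1)] with y hy1 hy2 hy3 hy4 hy5
    rw [transForm_eq_inChart hp hy1]
    have e1 : transMap p q ((chartAt E (1 : G)).symm y * g) x₀ = θ y := transMap_one
    have e2 : fderiv ℝ (transMap p q ((chartAt E (1 : G)).symm y * g)) x₀ =
        (fderiv ℝ θ y).comp (A y) := by
      -- Associativity: `x(yg) = (xy)g`.
      have e3 : transMap p q ((chartAt E (1 : G)).symm y * g) =ᶠ[𝓝 x₀] fun x => θ (M (x, y)) := by
        filter_upwards [(show ContinuousAt (fun x : E => (x, y)) x₀ by fun_prop).eventually hy3]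
          with x hx
        simp only [hθ, transMap, M, localMul]
        rw [(chartAt E (1 : G)).left_inv hx, mul_assoc]
      have e4 := hy4.hasFDerivAt.comp x₀ (f := fun x => (x, y)) (hasFDerivAt_prodMk_left x₀ y)
      have e5 : HasFDerivAt θ (fderiv ℝ θ y) (M (x₀, y)) := by
        rw [show M (x₀, y) = y from localMul_left_one hy5]
        exact hy2.hasFDerivAt
      exact e3.fderiv_eq.trans (e5.comp x₀ (f := fun x => M (x, y)) e4).fderiv
    rw [e1, e2]
    rfl
  · have hσx : σ x₀ = transForm p η g := by
      rw [transForm_eq_inChart hp hgq]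
    -- Symmetry of the second derivative of the product turns derivatives of right-invariant fields
    -- into those of left-invariant ones, which define the bracket.
    have hS : ∀ a c : E, fderiv ℝ (fderiv ℝ M) (x₀, x₀) (0, c) (a, 0) =
        fderiv ℝ (leftField ℝ G c) x₀ a := by
      intro a c
      rw [(hasFDerivAt_leftField hM c).fderiv]
      exact (hM.isSymmSndFDerivAt (by simp; norm_cast)) (0, c) (a, 0)
    intro a b c
    simp only [bracket_eq_real, ← hx₀, twoForm_sub, hD', hA', hS, hσx]
    have h1 := hcl a b c
    rw [twoForm_swap _ c a] at h1
    rw [twoForm_swap (transForm p η g) _ a, twoForm_swap (transForm p η g) _ b,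
      twoForm_swap (transForm p η g) _ c]
    linarith

end

end TranslatedForms

/-! ### The complex manifold `G ⧸ Γ` and its projection -/

section Quotient

variable {E : Type*} [NormedAddCommGroup E] [NormedSpace ℂ E]
  {G : Type*} [Group G] [TopologicalSpace G] [ChartedSpace E G] [LieGroup 𝓘(ℂ, E) ω G]
  (Γ : Subgroup G) [DiscreteTopology Γ]

/-- Local sections of `G → G ⧸ Γ` are locally given by right multiplication. -/
theorem exists_localInverseAt_mk_eq (x y : G)
    (hy : (QuotientGroup.mk y : G ⧸ Γ) ∈
      ((isLocalHomeomorph_mk (E := E) Γ).localInverseAt x).source) :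
    ∃ γ : G, ∀ᶠ z in 𝓝 y,
      (isLocalHomeomorph_mk (E := E) Γ).localInverseAt x (QuotientGroup.mk z) = z * γ := by
  have : IsTopologicalGroup G := topologicalGroup_of_lieGroup 𝓘(ℂ, E) ω
  set s := (isLocalHomeomorph_mk (E := E) Γ).localInverseAt x with hs
  let φ : G → G := fun z => z⁻¹ * s (QuotientGroup.mk z)
  have hmem : ∀ z : G, (QuotientGroup.mk z : G ⧸ Γ) ∈ s.source → φ z ∈ Γ := by
    intro z hz
    have h := IsLocalHomeomorph.apply_localInverseAt_of_mem (isLocalHomeomorph_mk (E := E) Γ) hz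
    exact QuotientGroup.eq.1 h.symm
  have hc : ContinuousAt (fun z : G => (QuotientGroup.mk z : G ⧸ Γ)) y :=
    QuotientGroup.continuous_mk.continuousAt
  have hφ : ContinuousAt φ y :=
    continuousAt_inv.mul (ContinuousAt.comp (g := s) (s.continuousAt hy) hc)
  -- `φ` is continuous at `y` and takes values in the discrete group `Γ` near `y`, so it is locally
  -- constant; its value is the required `γ`.
  obtain ⟨V, hV, hVΓ⟩ := nhds_inter_eq_singleton_of_mem_discrete
    (s := (Γ : Set G)) ⟨‹_›⟩ (hmem y hy)
  refine ⟨φ y, ?_⟩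
  filter_upwards [hφ.eventually hV,
    hc.eventually (s.open_source.mem_nhds hy)] with z hz hz'
  have h : φ z ∈ V ∩ (Γ : Set G) := ⟨hz, hmem z hz'⟩
  rw [hVΓ] at h
  rw [← Set.mem_singleton_iff.1 h, mul_inv_cancel_left]

/-- Locally this map is a right multiplication read in charts of `G`. It is both a transition map of
the quotient and the chart expression of the projection. -/
theorem contDiffAt_chartAt_localInverseAt (x₁ x₂ : G) {y : E} (hy : y ∈ (chartAt E x₁).target)
    (hy1 : (QuotientGroup.mk ((chartAt E x₁).symm y) : G ⧸ Γ) ∈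
      ((isLocalHomeomorph_mk (E := E) Γ).localInverseAt x₂).source)
    (hy2 : (isLocalHomeomorph_mk (E := E) Γ).localInverseAt x₂
      (QuotientGroup.mk ((chartAt E x₁).symm y)) ∈ (chartAt E x₂).source) :
    ContDiffAt ℂ ∞ (fun z => chartAt E x₂ ((isLocalHomeomorph_mk (E := E) Γ).localInverseAt x₂
      (QuotientGroup.mk ((chartAt E x₁).symm z)))) y := by
  obtain ⟨γ, hγ⟩ := exists_localInverseAt_mk_eq (E := E) Γ x₂ _ hy1
  rw [hγ.self_of_nhds] at hy2
  have h1 : ContMDiffAt 𝓘(ℂ, E) 𝓘(ℂ, E) ∞ (chartAt E x₁).symm y :=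
    (contMDiffOn_chart_symm (I := 𝓘(ℂ, E))).contMDiffAt ((chartAt E x₁).open_target.mem_nhds hy)
  have h2 : ContMDiffAt 𝓘(ℂ, E) 𝓘(ℂ, E) ∞ (chartAt E x₂) ((chartAt E x₁).symm y * γ) :=
    (contMDiffOn_chart (I := 𝓘(ℂ, E))).contMDiffAt ((chartAt E x₂).open_source.mem_nhds hy2)
  have h3 : ContMDiffAt 𝓘(ℂ, E) 𝓘(ℂ, E) ∞ (fun x : G => x * γ) ((chartAt E x₁).symm y) :=
    contMDiff_mul_right.contMDiffAt
  rw [← contMDiffAt_iff_contDiffAt]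
  refine ((ContMDiffAt.comp (I' := 𝓘(ℂ, E)) (f := fun x : G => x * γ) _ h2 h3).comp y
    h1).congr_of_eventuallyEq ?_
  filter_upwards [((chartAt E x₁).continuousAt_symm hy).eventually hγ] with z hz
  simp only [Function.comp_apply, hz]

theorem isManifold_quotient :
    letI : ChartedSpace E (G ⧸ Γ) := quotientChartedSpace Γ
    IsManifold 𝓘(ℂ, E) ∞ (G ⧸ Γ) := by
  let : ChartedSpace E (G ⧸ Γ) := quotientChartedSpace Γ
  refine isManifold_of_contDiffOn _ _ _ ?_
  rintro _ _ ⟨q, rfl⟩ ⟨q', rfl⟩ y hy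
  simp only [mfld_simps, IsLocalHomeomorph.localInverseAt_symm] at hy ⊢
  refine (contDiffAt_chartAt_localInverseAt Γ _ _ hy.1.1 hy.2.1 hy.2.2).contDiffWithinAt

theorem contMDiff_mk :
    letI : ChartedSpace E (G ⧸ Γ) := quotientChartedSpace Γ
    ContMDiff 𝓘(ℂ, E) 𝓘(ℂ, E) ∞ (QuotientGroup.mk : G → G ⧸ Γ) := by
  let : ChartedSpace E (G ⧸ Γ) := quotientChartedSpace Γ
  intro x
  rw [contMDiffAt_iff]
  refine ⟨QuotientGroup.continuous_mk.continuousAt, ?_⟩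
  have h1 := mem_chart_source E (QuotientGroup.mk x : G ⧸ Γ)
  have h2 := (chartAt E x).left_inv (mem_chart_source E x)
  simp only [mfld_simps, contDiffWithinAt_univ]
  refine contDiffAt_chartAt_localInverseAt Γ _ _ (mem_chart_target E x) ?_ ?_
  · rw [h2]; exact h1.1
  · rw [h2]; exact h1.2

/-- A local section gives a holomorphic left inverse in charts. -/
theorem mfderiv_mk_injective (x : G) :
    letI : ChartedSpace E (G ⧸ Γ) := quotientChartedSpace Γ
    Function.Injective (mfderiv 𝓘(ℂ, E) 𝓘(ℂ, E) (QuotientGroup.mk : G → G ⧸ Γ) x) := by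
  let : ChartedSpace E (G ⧸ Γ) := quotientChartedSpace Γ
  set φ := chartAt E x with hφ
  set e := chartAt E (QuotientGroup.mk x : G ⧸ Γ) with he
  have hx : φ.symm (φ x) = x := φ.left_inv (mem_chart_source E x)
  have h1 : (QuotientGroup.mk x : G ⧸ Γ) ∈ e.source := mem_chart_source E _
  have hmd : MDifferentiableAt 𝓘(ℂ, E) 𝓘(ℂ, E) (QuotientGroup.mk : G → G ⧸ Γ) x :=
    (contMDiff_mk Γ x).mdifferentiableAt (by simp)
  have hm : (mfderiv 𝓘(ℂ, E) 𝓘(ℂ, E) (QuotientGroup.mk : G → G ⧸ Γ) x : E →L[ℂ] E) =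
      fderiv ℂ (fun z => e (QuotientGroup.mk (φ.symm z))) (φ x) := by
    refine (MDifferentiableAt.mfderiv hmd).trans ?_
    simp only [mfld_simps, fderivWithin_univ, writtenInExtChartAt]
    rfl
  have hF : DifferentiableAt ℂ (fun z => e (QuotientGroup.mk (φ.symm z))) (φ x) := by
    refine (contDiffAt_chartAt_localInverseAt Γ _ _ (mem_chart_target E x) ?_ ?_).differentiableAt
      (by simp)
    · rw [hx]; exact h1.1
    · rw [hx]; exact h1.2
  set s := (isLocalHomeomorph_mk (E := E) Γ).localInverseAt x with hs
  have hxs : s (QuotientGroup.mk x) = x := IsLocalHomeomorph.localInverseAt_apply_self _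
  have hmks : (QuotientGroup.mk x : G ⧸ Γ) ∈ s.source :=
    IsLocalHomeomorph.apply_self_mem_localInverseAt_source _
  have hH : DifferentiableAt ℂ (fun z => φ (s (e.symm z)))
      (e (QuotientGroup.mk (φ.symm (φ x)))) := by
    -- The quotient chart comes from a chosen representative `r` of the coset, which may differ from
    -- `x`.
    obtain ⟨r, hr, hr'⟩ : ∃ r : G, (∀ z, e.symm z = QuotientGroup.mk ((chartAt E r).symm z)) ∧
        e.target ⊆ (chartAt E r).target := by
      refine ⟨_, fun z => ?_, fun z hz => hz.1⟩
      exact congrFun ((isLocalHomeomorph_mk (E := E) Γ).localInverseAt_symm _) _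
    have h5 : (QuotientGroup.mk ((chartAt E r).symm (e (QuotientGroup.mk x))) : G ⧸ Γ) =
        QuotientGroup.mk x := by
      rw [← hr, e.left_inv h1]
    simp only [hr, hx]
    refine (contDiffAt_chartAt_localInverseAt Γ r x (hr' (e.map_source h1)) ?_ ?_).differentiableAt
      (by simp)
    · rw [h5]; exact hmks
    · rw [h5, hxs]; exact mem_chart_source E x
  have hid : (fun z => φ (s (e.symm (e (QuotientGroup.mk (φ.symm z)))))) =ᶠ[𝓝 (φ x)] id := by
    have hc : ContinuousAt (fun z => (QuotientGroup.mk (φ.symm z) : G ⧸ Γ)) (φ x) :=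
      QuotientGroup.continuous_mk.continuousAt.comp (φ.continuousAt_symm (mem_chart_target E x))
    have hc' := φ.continuousAt_symm (mem_chart_target E x)
    filter_upwards [hc.eventually (e.open_source.mem_nhds (by simpa only [hx] using h1)),
      hc'.eventually (s.open_target.mem_nhds
        (by rw [hx]; exact IsLocalHomeomorph.self_mem_localInverseAt_target _)),
      φ.open_target.mem_nhds (mem_chart_target E x)] with z hz1 hz2 hz3
    have h6 : (QuotientGroup.mk (φ.symm z) : G ⧸ Γ) = s.symm (φ.symm z) := by
      rw [hs, IsLocalHomeomorph.localInverseAt_symm]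
    rw [e.left_inv hz1, h6, s.right_inv hz2, φ.right_inv hz3]
    rfl
  have h2 := (hH.hasFDerivAt.comp (φ x) hF.hasFDerivAt).fderiv.symm.trans
    (hid.fderiv_eq.trans fderiv_id)
  intro v w hvw
  have h3 : fderiv ℂ (fun z => e (QuotientGroup.mk (φ.symm z))) (φ x) v =
      fderiv ℂ (fun z => e (QuotientGroup.mk (φ.symm z))) (φ x) w := by
    rw [← hm]; exact hvw
  have h4 := fun u => congrArg (fun T : E →L[ℂ] E => T u) h2
  exact (h4 v).symm.trans ((congrArg _ h3).trans (h4 w))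

end Quotient

/-! ### Translates inherit the pointwise Kähler conditions -/

section FormProperties

variable {E : Type*} [NormedAddCommGroup E] [NormedSpace ℂ E]
  {G : Type*} [Group G] [TopologicalSpace G] [ChartedSpace E G]
  {N : Type*} [TopologicalSpace N] [ChartedSpace E N]
  {p : G → N} {η : TwoForm E N} {U : Set N}

/-- The differential at the identity of `x ↦ p (x * g)`. -/
def transLin (p : G → N) (g : G) : E →L[ℂ] E :=
  mfderiv 𝓘(ℂ, E) 𝓘(ℂ, E) (fun x => p (x * g)) 1

theorem comp_twoForm_apply (f : E [⋀^Fin 2]→L[ℝ] ℝ) (T : E →L[ℂ] E) (a b : E) :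
    f.compContinuousLinearMap (T.restrictScalars ℝ) ![a, b] = f ![T a, T b] := by
  refine congrArg f ?_
  ext i
  fin_cases i <;> rfl

theorem transForm_apply (g : G) (a b : E) : transForm p η g ![a, b] =
    (id (η (p (1 * g))) : E [⋀^Fin 2]→L[ℝ] ℝ)
      (![transLin p g a, transLin p g b] : Fin 2 → E) :=
  comp_twoForm_apply (E := E) (η (p (1 * g))) (transLin p g) a b

theorem transForm_I_smul (hη : IsKahlerFormOn η U) {g : G} (hg : p g ∈ U) (a b : E) :
    transForm p η g ![Complex.I • a, Complex.I • b] = transForm p η g ![a, b] := by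
  rw [transForm_apply, transForm_apply, map_smul (transLin (E := E) p g),
    map_smul (transLin (E := E) p g)]
  exact hη.map_I_smul _ (by rwa [one_mul]) _ _

/-- Right translations are invertible and `p` is an immersion, so positivity is pulled back along an
injective complex-linear map. -/
theorem transForm_pos [LieGroup 𝓘(ℂ, E) ∞ G] (hη : IsKahlerFormOn η U)
    (hp : ContMDiff 𝓘(ℂ, E) 𝓘(ℂ, E) ∞ p)
    (hinj : ∀ x, Function.Injective (mfderiv 𝓘(ℂ, E) 𝓘(ℂ, E) p x))
    {g : G} (hg : p g ∈ U) {a : E} (ha : a ≠ 0) :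
    0 < transForm p η g ![Complex.I • a, a] := by
  have hR : ∀ k x : G, MDifferentiableAt 𝓘(ℂ, E) 𝓘(ℂ, E) (fun y : G => y * k) x := fun k x =>
    (contMDiff_mul_right (n := ∞)).contMDiffAt.mdifferentiableAt (by simp)
  have h1 : Function.Injective (mfderiv 𝓘(ℂ, E) 𝓘(ℂ, E) (fun x : G => x * g) 1) := by
    have h2 := mfderiv_comp (1 : G) (hR g⁻¹ (1 * g)) (hR g 1)
    have h3 : (fun x : G => x * g⁻¹) ∘ (fun x : G => x * g) = id := by ext x; simp
    rw [h3, mfderiv_id] at h2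
    intro v w hvw
    have h4 := fun u : E => congrArg (fun T : E →L[ℂ] E => T u) h2
    exact (h4 v).trans ((congrArg _ hvw).trans (h4 w).symm)
  have h2 : Function.Injective (mfderiv 𝓘(ℂ, E) 𝓘(ℂ, E) (fun x => p (x * g)) 1) := by
    have h3 := mfderiv_comp (1 : G) ((hp (1 * g)).mdifferentiableAt (by simp)) (hR g 1)
    intro v w hvw
    have h4 := fun u : E => congrArg (fun T : E →L[ℂ] E => T u) h3
    exact h1 (hinj _ ((h4 v).symm.trans (hvw.trans (h4 w))))
  rw [transForm_apply, map_smul (transLin (E := E) p g)]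
  refine hη.pos _ (by rwa [one_mul]) _ fun h => ha (h2 (h.trans ?_))
  exact (map_zero (transLin (E := E) p g)).symm

/-- The source of invariance under `Γ`: multiplying `g` on the right by `Γ` does not change `x ↦
xgΓ`. -/
theorem transForm_congr {g k : G} (h : ∀ x, p (x * g) = p (x * k)) :
    transForm p η g = transForm p η k := by
  have key : ∀ F F' : G → N, F = F' → (η (F 1) : E [⋀^Fin 2]→L[ℝ] ℝ).compContinuousLinearMap
      ((mfderiv 𝓘(ℂ, E) 𝓘(ℂ, E) F 1 : E →L[ℂ] E).restrictScalars ℝ) =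
      (η (F' 1) : E [⋀^Fin 2]→L[ℝ] ℝ).compContinuousLinearMap
      ((mfderiv 𝓘(ℂ, E) 𝓘(ℂ, E) F' 1 : E →L[ℂ] E).restrictScalars ℝ) := by
    rintro F _ rfl; rfl
  exact key _ _ (funext h)

end FormProperties

/-! ### Derivatives of translates along curves in `G₀` -/

section Curves

variable {E : Type*} [NormedAddCommGroup E] [NormedSpace ℂ E]
  {E₀ : Type*} [NormedAddCommGroup E₀] [NormedSpace ℝ E₀]
  {G : Type*} [Group G] [TopologicalSpace G] [ChartedSpace E G]
  {G₀ : Subgroup G} [ChartedSpace E₀ G₀]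
  {N : Type*} [TopologicalSpace N] [ChartedSpace E N]
  {p : G → N} {η : TwoForm E N} {U : Set N}

/-- Vectors of `𝔤₀` are velocities of curves in `G₀`. -/
theorem exists_curve (h : ContMDiffAt 𝓘(ℝ, E₀) 𝓘(ℝ, E) ∞ (Subtype.val : G₀ → G) 1) {c : E}
    (hc : c ∈ lieAlg E E₀ G₀) :
    ∃ γ : ℝ → G₀, γ 0 = 1 ∧ ContinuousAt γ 0 ∧
      HasStrictDerivAt (fun t => chartAt E (1 : G) (γ t : G)) c 0 := by
  obtain ⟨v, hv⟩ := (mem_lieAlg_iff h c).1 hc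
  set y₀ := chartAt E₀ (1 : G₀) 1 with hy₀
  have h1 : HasStrictDerivAt (fun t : ℝ => y₀ + t • v) v 0 := by
    simpa using ((hasStrictDerivAt_id (0 : ℝ)).smul_const v).const_add y₀
  have h0 : y₀ + (0 : ℝ) • v = y₀ := by simp
  refine ⟨fun t => (chartAt E₀ (1 : G₀)).symm (y₀ + t • v), ?_, ?_, ?_⟩
  · simp only [h0]
    exact chartAt_symm_one
  · refine ContinuousAt.comp_of_eq ((chartAt E₀ (1 : G₀)).continuousAt_symm
      (mem_chart_target E₀ 1)) h1.hasDerivAt.continuousAt h0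
  · have h2 : HasStrictFDerivAt (localVal E E₀ G₀) (fderiv ℝ (localVal E E₀ G₀) y₀)
        (y₀ + (0 : ℝ) • v) := by
      rw [h0]
      exact (contDiffAt_localVal h).hasStrictFDerivAt (by simp)
    have h3 := h2.comp_hasStrictDerivAt 0 h1
    rw [hv] at h3
    exact h3

theorem eventually_chartAt_symm_curve {γ : ℝ → G₀} (h0 : γ 0 = 1) (hγ : ContinuousAt γ 0) :
    ∀ᶠ t in 𝓝 (0 : ℝ), (chartAt E (1 : G)).symm (chartAt E (1 : G) (γ t : G)) = γ t := by
  have h1 : ContinuousAt (fun t => (γ t : G)) 0 := continuous_subtype_val.continuousAt.comp hγ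
  have h2 : ((γ 0 : G₀) : G) ∈ (chartAt E (1 : G)).source := by
    rw [h0]; exact mem_chart_source E (1 : G)
  filter_upwards [h1.eventually ((chartAt E (1 : G)).open_source.mem_nhds h2)] with t ht
  exact (chartAt E (1 : G)).left_inv ht

variable [LieGroup 𝓘(ℂ, E) ∞ G] [IsManifold 𝓘(ℂ, E) ∞ N]

/-- The derivatives of a translated form along curves of `G₀`, and their cyclic sum. -/
theorem exists_hasDerivAt_transForm_curve (hp : ContMDiff 𝓘(ℂ, E) 𝓘(ℂ, E) ∞ p)
    (hη : IsKahlerFormOn η U) (hU : IsOpen U) {g : G} (hg : p g ∈ U) :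
    ∃ D : E → E → E → ℝ,
      (∀ (γ : ℝ → G₀) (c a b : E), γ 0 = 1 → ContinuousAt γ 0 →
        HasStrictDerivAt (fun t => chartAt E (1 : G) (γ t : G)) c 0 →
        HasDerivAt (fun t => transForm p η (γ t * g) ![a, b]) (D c a b) 0) ∧
      ∀ a b c : E, D c a b + D a b c + D b c a =
        transForm p η g ![Bracket.bracket (L := GroupLieAlgebra 𝓘(ℂ, E) G)
          (M := GroupLieAlgebra 𝓘(ℂ, E) G) a c, b] +
        transForm p η g ![Bracket.bracket (L := GroupLieAlgebra 𝓘(ℂ, E) G)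
          (M := GroupLieAlgebra 𝓘(ℂ, E) G) b a, c] +
        transForm p η g ![Bracket.bracket (L := GroupLieAlgebra 𝓘(ℂ, E) G)
          (M := GroupLieAlgebra 𝓘(ℂ, E) G) c b, a] := by
  obtain ⟨D, hD, hD'⟩ := exists_hasFDerivAt_transForm_mul hp hη hU hg
  refine ⟨fun c a b => D c ![a, b], fun γ c a b h0 hγ hγ' => ?_, hD'⟩
  have h1 : HasFDerivAt (fun y => transForm p η ((chartAt E (1 : G)).symm y * g)) D
      (chartAt E (1 : G) (γ 0 : G)) := by
    rw [h0]; exact hD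
  have h2 := h1.comp_hasDerivAt 0 hγ'.hasDerivAt
  have h3 := (ContinuousAlternatingMap.apply ℝ E ℝ ![a, b]).hasFDerivAt.comp_hasDerivAt 0 h2
  refine h3.congr_of_eventuallyEq ?_
  filter_upwards [eventually_chartAt_symm_curve (E := E) h0 hγ] with t ht
  simp only [Function.comp_apply, ht]
  rfl

/-- Strict differentiability in `(t, g)` at `(0, g₀)` gives the estimate with the fixed slope `L` in
place of `d g`, uniformly for `g` near `g₀`; the same estimate then shows that `d g` is close to
`L`. -/
theorem eventually_abs_transForm_sub_le (hp : ContMDiff 𝓘(ℂ, E) 𝓘(ℂ, E) ∞ p)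
    (hη : IsKahlerFormOn η U) (hU : IsOpen U) {γ : ℝ → G₀} {c : E} (a b : E) (h0 : γ 0 = 1)
    (hγ : ContinuousAt γ 0) (hγ' : HasStrictDerivAt (fun t => chartAt E (1 : G) (γ t : G)) c 0)
    {d : G → ℝ} (hd : ∀ g, p g ∈ U → HasDerivAt (fun t => transForm p η (γ t * g) ![a, b]) (d g) 0)
    {g₀ : G} (hg₀ : p g₀ ∈ U) {ε : ℝ} (hε : 0 < ε) :
    ∀ᶠ x in 𝓝 g₀ ×ˢ 𝓝 (0 : ℝ), |transForm p η (γ x.2 * x.1) ![a, b] - transForm p η x.1 ![a, b] -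
      x.2 * d x.1| ≤ ε * |x.2| := by
  set e := chartAt E g₀ with he
  set x₀ := chartAt E (1 : G) 1 with hx₀
  have heg : e.symm (e g₀) = g₀ := e.left_inv (mem_chart_source E g₀)
  let κ : E × E → E := fun z => e ((chartAt E (1 : G)).symm z.1 * e.symm z.2)
  have hκ : ContDiffAt ℂ ∞ κ (x₀, e g₀) := by
    rw [← contMDiffAt_iff_contDiffAt]
    have h1 : ContMDiffAt 𝓘(ℂ, E × E) 𝓘(ℂ, E) ∞
        (fun z : E × E => (chartAt E (1 : G)).symm z.1) (x₀, e g₀) :=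
      ContMDiffAt.comp (x₀, e g₀) (contMDiffAt_chartAt_symm (1 : G))
        contDiff_fst.contMDiff.contMDiffAt
    have h2 : ContMDiffAt 𝓘(ℂ, E × E) 𝓘(ℂ, E) ∞ (fun z : E × E => e.symm z.2) (x₀, e g₀) :=
      ContMDiffAt.comp (x₀, e g₀) (contMDiffAt_chartAt_symm g₀)
        contDiff_snd.contMDiff.contMDiffAt
    refine ContMDiffAt.comp_of_eq (contMDiffAt_chartAt g₀) (h1.mul h2) ?_
    simp [hx₀, heg]
  let u : ℝ × E → ℝ := fun z =>
    transForm p η (e.symm (κ (chartAt E (1 : G) (γ z.1 : G), z.2))) ![a, b]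
  obtain ⟨u', hu⟩ : ∃ u', HasStrictFDerivAt u u' (0, e g₀) := by
    obtain ⟨D, hD⟩ := hasStrictFDerivAt_transForm hp hη hU hg₀
    have h1 : HasStrictFDerivAt (fun z : ℝ × E => (chartAt E (1 : G) (γ z.1 : G), z.2)) _
        (0, e g₀) :=
      (HasStrictFDerivAt.comp (g := fun t => chartAt E (1 : G) (γ t : G)) (f := Prod.fst) (0, e g₀)
        hγ'.hasStrictFDerivAt (hasStrictFDerivAt_fst (𝕜 := ℝ))).prodMk
          (hasStrictFDerivAt_snd (𝕜 := ℝ))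
    have h2 : HasStrictFDerivAt κ (fderiv ℝ κ (x₀, e g₀))
        (chartAt E (1 : G) (γ (0, e g₀).1 : G), (0, e g₀).2) := by
      simp only [h0]
      exact (hκ.restrict_scalars ℝ).hasStrictFDerivAt (by simp)
    have h3 := h2.comp (0, e g₀) h1
    have h4 : κ (chartAt E (1 : G) (γ 0 : G), e g₀) = e g₀ := by
      simp only [κ, h0, heg]
      rw [Subgroup.coe_one, chartAt_symm_one, one_mul]
    have h5 : HasStrictFDerivAt (fun z => transForm p η (e.symm z)) D
        (κ (chartAt E (1 : G) (γ (0, e g₀).1 : G), (0, e g₀).2)) := by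
      simp only [h4]
      exact hD
    exact ⟨_, (ContinuousAlternatingMap.apply ℝ E ℝ ![a, b]).hasStrictFDerivAt.comp (0, e g₀)
      (h5.comp (0, e g₀) h3)⟩
  have hes : ∀ᶠ x in 𝓝 g₀, x ∈ e.source := e.open_source.mem_nhds (mem_chart_source E g₀)
  have hux : ∀ᶠ x in 𝓝 g₀ ×ˢ 𝓝 (0 : ℝ),
      u (x.2, e x.1) = transForm p η (γ x.2 * x.1) ![a, b] := by
    have : IsTopologicalGroup G := topologicalGroup_of_lieGroup 𝓘(ℂ, E) ∞
    have hγc : Filter.Tendsto (fun t => (γ t : G)) (𝓝 0) (𝓝 1) := by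
      have h1 := (continuous_subtype_val.continuousAt.comp hγ).tendsto
      simpa [Function.comp_def, h0] using h1
    have hm : Filter.Tendsto (fun x : G × ℝ => (γ x.2 : G) * x.1) (𝓝 g₀ ×ˢ 𝓝 (0 : ℝ))
        (𝓝 (1 * g₀)) := (hγc.comp Filter.tendsto_snd).mul Filter.tendsto_fst
    rw [one_mul] at hm
    filter_upwards [Filter.tendsto_fst.eventually hes, hm.eventually hes,
      Filter.tendsto_snd.eventually (eventually_chartAt_symm_curve (E := E) h0 hγ)]
      with x hx1 hx2 hx3
    simp only [u, κ, hx3, e.left_inv hx1, e.left_inv hx2]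
  have hlim : Filter.Tendsto (fun x : G × ℝ => (((x.2, e x.1) : ℝ × E), ((0, e x.1) : ℝ × E)))
      (𝓝 g₀ ×ˢ 𝓝 (0 : ℝ)) (𝓝 ((0, e g₀), (0, e g₀))) := by
    have h1 : Filter.Tendsto (fun x : G × ℝ => e x.1) (𝓝 g₀ ×ˢ 𝓝 (0 : ℝ)) (𝓝 (e g₀)) :=
      (e.continuousAt (mem_chart_source E g₀)).tendsto.comp Filter.tendsto_fst
    exact (Filter.tendsto_snd.prodMk_nhds h1).prodMk_nhds (tendsto_const_nhds.prodMk_nhds h1)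
  have hU' : ∀ᶠ g in 𝓝 g₀, p g ∈ U :=
    hp.continuous.continuousAt.eventually (hU.mem_nhds hg₀)
  set L := u' (1, 0) with hL
  have h1 : ∀ᶠ x in 𝓝 g₀ ×ˢ 𝓝 (0 : ℝ),
      |transForm p η (γ x.2 * x.1) ![a, b] - transForm p η x.1 ![a, b] - x.2 * L| ≤
        ε / 2 * |x.2| := by
    have h2 := hlim.eventually (hu.isLittleO.def (half_pos hε))
    have h3 : ∀ᶠ x in 𝓝 g₀ ×ˢ 𝓝 (0 : ℝ), u (0, e x.1) = transForm p η x.1 ![a, b] := by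
      filter_upwards [Filter.tendsto_fst.eventually hes] with x hx
      simp only [u, κ, h0]
      rw [Subgroup.coe_one, chartAt_symm_one, one_mul, e.left_inv hx, e.left_inv hx]
    filter_upwards [h2, h3, hux] with x hx2 hx3 hx4
    have h5 : ((x.2, e x.1) : ℝ × E) - (0, e x.1) = x.2 • ((1, 0) : ℝ × E) := by
      ext <;> simp
    simp only [h5, map_smul, norm_smul, hx3, hx4, smul_eq_mul] at hx2
    simpa [hL] using hx2
  -- `d g - L` is the derivative at `0` of a function whose increments are at most `ε / 2 * |t|`.
  have h2 : ∀ᶠ x in 𝓝 g₀, |d x - L| ≤ ε / 2 := by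
    filter_upwards [h1.curry, hU'] with g hg hgU
    have h3 := (hd g hgU).sub ((hasDerivAt_id (0 : ℝ)).mul_const L)
    rw [one_mul] at h3
    refine h3.le_of_lip' (by positivity) ?_
    filter_upwards [hg] with t ht
    simpa [h0, sub_right_comm] using ht
  filter_upwards [h1, Filter.tendsto_fst.eventually h2] with x hx1 hx2
  have h3 : transForm p η (γ x.2 * x.1) ![a, b] - transForm p η x.1 ![a, b] - x.2 * d x.1 =
      (transForm p η (γ x.2 * x.1) ![a, b] - transForm p η x.1 ![a, b] - x.2 * L) -
        x.2 * (d x.1 - L) := by ring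
  rw [h3]
  refine (abs_sub _ _).trans ?_
  rw [abs_mul]
  nlinarith [abs_nonneg x.2]

end Curves

/-! ### Uniformity over a cocompact quotient -/

section Compactness

variable {H : Type*} [Group H] [TopologicalSpace H] [IsTopologicalGroup H] {K : Subgroup H}
  [CompactSpace (H ⧸ K)]

/-- A locally uniform `K`-invariant property of points of `H` holds uniformly if `H ⧸ K` is
compact. -/
theorem eventually_forall_of_compactSpace_quotient {T : Type*} {l : Filter T} {Q : H → T → Prop}
    (hK : ∀ g, ∀ k ∈ K, ∀ t, Q g t → Q (g * k) t)
    (hQ : ∀ g, ∀ᶠ x in 𝓝 g ×ˢ l, Q x.1 x.2) : ∀ᶠ t in l, ∀ g, Q g t := by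
  suffices h : ∀ᶠ t in l, ∀ q ∈ (Set.univ : Set (H ⧸ K)), ∀ g : H, (g : H ⧸ K) = q → Q g t from
    h.mono fun t ht g => ht _ trivial g rfl
  refine isCompact_univ.induction_on (p := fun s : Set (H ⧸ K) =>
    ∀ᶠ t in l, ∀ q ∈ s, ∀ g : H, (g : H ⧸ K) = q → Q g t) (by simp)
    (fun s t hst h => h.mono fun _ hx q hq => hx q (hst hq))
    (fun s t hs ht => by
      filter_upwards [hs, ht] with x hx hx' q hq
      exact hq.elim (hx q) (hx' q)) ?_
  intro q _
  obtain ⟨g, rfl⟩ := QuotientGroup.mk_surjective q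
  obtain ⟨P, hP, R, hR, hPR⟩ := Filter.eventually_prod_iff.1 (hQ g)
  refine ⟨QuotientGroup.mk '' {x | P x},
    mem_nhdsWithin_of_mem_nhds (QuotientGroup.isOpenMap_coe.image_mem_nhds hP), ?_⟩
  filter_upwards [hR] with t ht
  rintro _ ⟨x, hx, rfl⟩ y hy
  have h1 := hK x (x⁻¹ * y) (QuotientGroup.eq.1 hy.symm) t (hPR hx ht)
  rwa [mul_inv_cancel_left] at h1

/-- The bound itself is the parameter, tending to infinity; for the positive lower bound below it
tends to `0` from the right. -/
theorem exists_abs_le_of_compactSpace_quotient {f : H → ℝ} (hf : Continuous f)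
    (hK : ∀ g, ∀ k ∈ K, f (g * k) = f g) : ∃ B, ∀ g, |f g| ≤ B := by
  refine (eventually_forall_of_compactSpace_quotient (K := K) (l := Filter.atTop)
    (Q := fun g B => |f g| ≤ B) (fun g k hk B h => by rwa [hK g k hk]) fun g => ?_).exists
  have h1 : ∀ᶠ x in 𝓝 g, |f x| < |f g| + 1 := hf.abs.continuousAt.eventually_lt_const (by simp)
  filter_upwards [h1.prod_mk (Filter.eventually_ge_atTop (|f g| + 1))] with x hx
  exact hx.1.le.trans hx.2

theorem exists_pos_le_of_compactSpace_quotient {f : H → ℝ} (hf : Continuous f)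
    (hK : ∀ g, ∀ k ∈ K, f (g * k) = f g) (hpos : ∀ g, 0 < f g) : ∃ ε > 0, ∀ g, ε ≤ f g := by
  have h := eventually_forall_of_compactSpace_quotient (K := K) (l := 𝓝[>] 0)
    (Q := fun g ε => ε ≤ f g) (fun g k hk B h => by rwa [hK g k hk]) fun g => ?_
  · obtain ⟨ε, h1, h2⟩ := (h.and self_mem_nhdsWithin).exists
    exact ⟨ε, h2, h1⟩
  have h1 : ∀ᶠ x in 𝓝 g, f g / 2 < f x :=
    hf.continuousAt.eventually_const_lt (half_lt_self (hpos g))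
  have h2 : ∀ᶠ ε in 𝓝[>] (0 : ℝ), ε < f g / 2 :=
    (eventually_lt_nhds (half_pos (hpos g))).filter_mono nhdsWithin_le_nhds
  filter_upwards [h1.prod_mk h2] with x hx
  exact (hx.2.trans hx.1).le

end Compactness

/-! ### Averaging a Kähler form over `G₀` -/

section Averaging

variable {E : Type*} [NormedAddCommGroup E] [NormedSpace ℂ E]
  {E₀ : Type*} [NormedAddCommGroup E₀] [NormedSpace ℝ E₀]
  {G : Type*} [Group G] [TopologicalSpace G] [ChartedSpace E G]
  {G₀ : Subgroup G} [ChartedSpace E₀ G₀]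
  {N : Type*} [TopologicalSpace N] [ChartedSpace E N]
  {p : G → N} {η : TwoForm E N} {U : Set N}

/-- The average over `G₀` of the right translates of a form, with respect to a mean `M`. -/
def averageForm (M : (G₀ → ℝ) →ₗ[ℝ] ℝ) (p : G → N) (η : TwoForm E N) : E [⋀^Fin 2]→ₗ[ℝ] ℝ :=
  M.compAlternatingMap (AlternatingMap.pi fun g : G₀ => (transForm p η g).toAlternatingMap)

theorem averageForm_apply (M : (G₀ → ℝ) →ₗ[ℝ] ℝ) (v : Fin 2 → E) :
    averageForm M p η v = M fun g : G₀ => transForm p η g v := rfl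

variable [LieGroup 𝓘(ℂ, E) ∞ G] [IsManifold 𝓘(ℂ, E) ∞ N]

/-- Along `G₀` a Kähler form varies, at first order in `t`, uniformly on cosets of a cocompact
subgroup. -/
theorem eventually_forall_abs_transForm_sub_le {K : Subgroup G₀} [CompactSpace (G₀ ⧸ K)]
    (hp : ContMDiff 𝓘(ℂ, E) 𝓘(ℂ, E) ∞ p) (hη : IsKahlerFormOn η U) (hU : IsOpen U)
    (hpU : ∀ g ∈ G₀, p g ∈ U) (hpK : ∀ x : G, ∀ k ∈ K, p (x * k) = p x)
    {γ : ℝ → G₀} {c : E} (a b : E) (h0 : γ 0 = 1) (hγ : ContinuousAt γ 0)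
    (hγ' : HasStrictDerivAt (fun t => chartAt E (1 : G) (γ t : G)) c 0)
    {d : G → ℝ} (hd : ∀ g, p g ∈ U → HasDerivAt (fun t => transForm p η (γ t * g) ![a, b]) (d g) 0)
    {ε : ℝ} (hε : 0 < ε) :
    ∀ᶠ t in 𝓝 (0 : ℝ), ∀ g : G₀, |transForm p η (γ t * g) ![a, b] - transForm p η g ![a, b] -
      t * d g| ≤ ε * |t| := by
  have : IsTopologicalGroup G := topologicalGroup_of_lieGroup 𝓘(ℂ, E) ∞
  have hW : ∀ g : G, ∀ k ∈ K, transForm p η (g * (k : G₀)) = transForm p η g := fun g k hk =>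
    transForm_congr fun x => by rw [← mul_assoc, hpK _ k hk]
  refine eventually_forall_of_compactSpace_quotient (K := K) (fun g k hk t h => ?_) fun g => ?_
  · have h1 := hd (g * k : G₀) (hpU _ (g * k).2)
    simp only [Subgroup.coe_mul, ← mul_assoc, hW _ k hk] at h1 ⊢
    rw [h1.unique (hd g (hpU g g.2))]
    exact h
  · have h1 := eventually_abs_transForm_sub_le hp hη hU a b h0 hγ hγ' hd (hpU g g.2) hε
    exact ((continuous_subtype_val.tendsto g).prodMap Filter.tendsto_id).eventually h1

theorem abs_mean_le {H : Type*} [Group H] {M : (H → ℝ) →ₗ[ℝ] ℝ}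
    (hM : ∀ f : H → ℝ, (∃ B, ∀ g, |f g| ≤ B) →
      (∀ C, (∀ g, f g ≤ C) → M f ≤ C) ∧ ∀ h, M (fun g => f (h * g)) = M f)
    {f : H → ℝ} {C : ℝ} (hf : ∀ g, |f g| ≤ C) : |M f| ≤ C := by
  refine abs_le'.2 ⟨(hM f ⟨C, hf⟩).1 C fun g => (le_abs_self _).trans (hf g), ?_⟩
  rw [← map_neg]
  exact (hM (-f) ⟨C, fun g => by simpa using hf g⟩).1 C fun g => (neg_le_abs _).trans (hf g)

/-- A Kähler form near `G₀ ⧸ K`, averaged over `G₀`, gives an alternating form on the Lie algebra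
that is positive, invariant under `i`, and a cocycle on the Lie algebra of `G₀`. -/
theorem exists_averaged_form {K : Subgroup G₀} [CompactSpace (G₀ ⧸ K)] (hG₀ : Group.IsSolvable G₀)
    (hval : ContMDiffAt 𝓘(ℝ, E₀) 𝓘(ℝ, E) ∞ (Subtype.val : G₀ → G) 1)
    (hp : ContMDiff 𝓘(ℂ, E) 𝓘(ℂ, E) ∞ p) (hη : IsKahlerFormOn η U) (hU : IsOpen U)
    (hinj : ∀ x, Function.Injective (mfderiv 𝓘(ℂ, E) 𝓘(ℂ, E) p x))
    (hpU : ∀ g ∈ G₀, p g ∈ U) (hpK : ∀ x : G, ∀ k ∈ K, p (x * k) = p x) :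
    ∃ w : E [⋀^Fin 2]→ₗ[ℝ] ℝ,
      (∀ a ∈ lieAlg E E₀ G₀, ∀ b ∈ lieAlg E E₀ G₀, ∀ c ∈ lieAlg E E₀ G₀,
        w ![Bracket.bracket (L := GroupLieAlgebra 𝓘(ℂ, E) G)
          (M := GroupLieAlgebra 𝓘(ℂ, E) G) a c, b] +
        w ![Bracket.bracket (L := GroupLieAlgebra 𝓘(ℂ, E) G)
          (M := GroupLieAlgebra 𝓘(ℂ, E) G) b a, c] +
        w ![Bracket.bracket (L := GroupLieAlgebra 𝓘(ℂ, E) G)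
          (M := GroupLieAlgebra 𝓘(ℂ, E) G) c b, a] = 0) ∧
      (∀ a b : E, w ![Complex.I • a, Complex.I • b] = w ![a, b]) ∧
      ∀ a : E, a ≠ 0 → 0 < w ![Complex.I • a, a] := by
  have : IsTopologicalGroup G := topologicalGroup_of_lieGroup 𝓘(ℂ, E) ∞
  obtain ⟨M, hM⟩ := exists_invariant_mean hG₀
  have hcont : ∀ v : Fin 2 → E, Continuous fun g : G₀ => transForm p η g v := fun v =>
    continuous_iff_continuousAt.2 fun g =>
      ((ContinuousAlternatingMap.apply ℝ E ℝ v).continuous.continuousAt.comp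
        (continuousAt_transForm hp hη hU (hpU g g.2))).comp continuous_subtype_val.continuousAt
  have hinv : ∀ v : Fin 2 → E, ∀ g : G₀, ∀ k ∈ K,
      transForm p η (g * k : G₀) v = transForm p η g v := fun v g k hk =>
    congrArg (fun f => f v) (transForm_congr (k := (g : G))
      fun x => by rw [Subgroup.coe_mul, ← mul_assoc, hpK _ k hk])
  have hbdd : ∀ v : Fin 2 → E, ∃ B, ∀ g : G₀, |transForm p η g v| ≤ B := fun v =>
    exists_abs_le_of_compactSpace_quotient (hcont v) (hinv v)
  refine ⟨averageForm M p η, fun a ha b hb c hc => ?_, fun a b => ?_, fun a ha => ?_⟩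
  · obtain ⟨γa, ha0, ha1, ha2⟩ := exists_curve hval ha
    obtain ⟨γb, hb0, hb1, hb2⟩ := exists_curve hval hb
    obtain ⟨γc, hc0, hc1, hc2⟩ := exists_curve hval hc
    choose! D hD hcyc using fun (g : G) (hg : p g ∈ U) =>
      exists_hasDerivAt_transForm_curve (G₀ := G₀) hp hη hU hg
    have hQ : (fun g : G₀ => D g c a b + D g a b c + D g b c a) = _ :=
      funext fun g : G₀ => hcyc g (hpU g g.2) a b c
    simp only [averageForm_apply, ← map_add]
    refine (congrArg M hQ.symm).trans ?_
    -- It suffices to bound the mean of the cyclic sum by every `ε > 0`; three uniform first-order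
    -- estimates contribute `ε / 3` each.
    rw [← abs_nonpos_iff]
    refine le_of_forall_pos_le_add fun ε hε => ?_
    rw [zero_add]
    have h1 := eventually_forall_abs_transForm_sub_le (K := K) hp hη hU hpU hpK a b hc0 hc1 hc2
      (d := fun g => D g c a b) (fun g hg => hD g hg γc c a b hc0 hc1 hc2)
      (show 0 < ε / 3 by positivity)
    have h2 := eventually_forall_abs_transForm_sub_le (K := K) hp hη hU hpU hpK b c ha0 ha1 ha2
      (d := fun g => D g a b c) (fun g hg => hD g hg γa a b c ha0 ha1 ha2)
      (show 0 < ε / 3 by positivity)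
    have h3 := eventually_forall_abs_transForm_sub_le (K := K) hp hη hU hpU hpK c a hb0 hb1 hb2
      (d := fun g => D g b c a) (fun g hg => hD g hg γb b c a hb0 hb1 hb2)
      (show 0 < ε / 3 by positivity)
    obtain ⟨t, ⟨h1, h2, h3⟩, ht⟩ := (((h1.and (h2.and h3)).filter_mono
      (nhdsWithin_le_nhds (s := Set.Ioi 0))).and self_mem_nhdsWithin).exists
    replace ht : 0 < t := ht
    rw [abs_of_pos ht] at h1 h2 h3
    -- Left invariance kills the increments, so only `t` times the mean of the derivatives remains,
    -- of size at most `ε * t`.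
    have hMd : ∀ (v : Fin 2 → E) (h : G₀), M (fun g : G₀ => transForm p η (h * g) v -
        transForm p η g v) = 0 := fun v h => by
      refine (map_sub M (fun g : G₀ => transForm p η (h * g : G₀) v)
        (fun g : G₀ => transForm p η g v)).trans ?_
      rw [(hM (fun g : G₀ => transForm p η g v) (hbdd v)).2 h, sub_self]
    have h4 : |M fun g : G₀ => (transForm p η (γc t * g) ![a, b] - transForm p η g ![a, b]) +
        (transForm p η (γa t * g) ![b, c] - transForm p η g ![b, c]) +
        (transForm p η (γb t * g) ![c, a] - transForm p η g ![c, a]) -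
        t * (D g c a b + D g a b c + D g b c a)| ≤ ε * t := by
      refine abs_mean_le hM fun g => ?_
      have e1 := abs_le.1 (h1 g)
      have e2 := abs_le.1 (h2 g)
      have e3 := abs_le.1 (h3 g)
      exact abs_le.2 ⟨by linarith, by linarith⟩
    have h5 : (M fun g : G₀ => (transForm p η (γc t * g) ![a, b] - transForm p η g ![a, b]) +
        (transForm p η (γa t * g) ![b, c] - transForm p η g ![b, c]) +
        (transForm p η (γb t * g) ![c, a] - transForm p η g ![c, a]) -
        t * (D g c a b + D g a b c + D g b c a)) =
        -(t * M fun g : G₀ => D g c a b + D g a b c + D g b c a) := by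
      have e := ((M.map_sub _ _).trans (congrArg₂ (· - ·)
        ((M.map_add _ _).trans (congrArg₂ (· + ·) ((M.map_add _ _).trans (congrArg₂ (· + ·)
          (hMd ![a, b] (γc t)) (hMd ![b, c] (γa t)))) (hMd ![c, a] (γb t))))
        (M.map_smul t fun g : G₀ => D g c a b + D g a b c + D g b c a)))
      refine e.trans ?_
      simp
    rw [h5, abs_neg, abs_mul, abs_of_pos ht, mul_comm] at h4
    exact le_of_mul_le_mul_right h4 ht
  · simp only [averageForm_apply]
    exact congrArg M (funext fun g => transForm_I_smul hη (hpU g g.2) a b)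
  · obtain ⟨ε, hε, h⟩ := exists_pos_le_of_compactSpace_quotient (hcont ![Complex.I • a, a])
      (hinv _) fun g => transForm_pos hη hp hinj (hpU g g.2) ha
    obtain ⟨B, hB⟩ := hbdd ![Complex.I • a, a]
    -- A mean is controlled through upper bounds, so the uniform lower bound is applied to the
    -- negative.
    have h1 := (hM (-fun g : G₀ => transForm p η g ![Complex.I • a, a])
      ⟨B, fun g => by simpa using hB g⟩).1 (-ε) fun g => neg_le_neg (h g)
    rw [map_neg] at h1
    rw [averageForm_apply]
    linarith

end Averaging

/-! ### Invariant Kähler forms -/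

section InvariantForms

variable {E : Type*} [NormedAddCommGroup E] [NormedSpace ℂ E]
  {E₀ : Type*} [NormedAddCommGroup E₀] [NormedSpace ℝ E₀]
  {G : Type*} [Group G] [TopologicalSpace G] [ChartedSpace E G]
  {G₀ : Subgroup G} [ChartedSpace E₀ G₀] {η : TwoForm E G} {U : Set G}

theorem IsInvariantKahlerForm.transForm_eq (h : IsInvariantKahlerForm G₀ η U) {g : G}
    (hg : g ∈ G₀) : transForm id η g = (η 1 : E [⋀^Fin 2]→L[ℝ] ℝ) :=
  h.invariant 1 (h.subset G₀.one_mem) g hg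

/-- An invariant Kähler form is a cocycle on the Lie algebra of `G₀`. -/
theorem IsInvariantKahlerForm.cyclic_sum_eq_zero [LieGroup 𝓘(ℂ, E) ∞ G]
    (h : IsInvariantKahlerForm G₀ η U)
    (hval : ContMDiffAt 𝓘(ℝ, E₀) 𝓘(ℝ, E) ∞ (Subtype.val : G₀ → G) 1) {a b c : E}
    (ha : a ∈ lieAlg E E₀ G₀) (hb : b ∈ lieAlg E E₀ G₀) (hc : c ∈ lieAlg E E₀ G₀) :
    transForm id η (1 : G) ![Bracket.bracket (L := GroupLieAlgebra 𝓘(ℂ, E) G)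
      (M := GroupLieAlgebra 𝓘(ℂ, E) G) a c, b] +
    transForm id η (1 : G) ![Bracket.bracket (L := GroupLieAlgebra 𝓘(ℂ, E) G)
      (M := GroupLieAlgebra 𝓘(ℂ, E) G) b a, c] +
    transForm id η (1 : G) ![Bracket.bracket (L := GroupLieAlgebra 𝓘(ℂ, E) G)
      (M := GroupLieAlgebra 𝓘(ℂ, E) G) c b, a] = 0 := by
  have : IsManifold 𝓘(ℂ, E) ∞ G := ContMDiffMul.toIsManifold
  obtain ⟨D, hD, hcyc⟩ := exists_hasDerivAt_transForm_curve (G₀ := G₀) (p := id) (g := (1 : G))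
    contMDiff_id h.isKahler h.isOpen (h.subset G₀.one_mem)
  -- By invariance the translates are constant along curves in `G₀`.
  have hzero : ∀ x ∈ lieAlg E E₀ G₀, ∀ y z : E, D x y z = 0 := fun x hx y z => by
    obtain ⟨γ, h0, h1, h2⟩ := exists_curve hval hx
    have h3 := hD γ x y z h0 h1 h2
    have h4 : (fun t => transForm id η (γ t * 1 : G) ![y, z]) =
        fun _ => (η 1 : E [⋀^Fin 2]→L[ℝ] ℝ) ![y, z] := funext fun t =>
      congrArg (fun f : E [⋀^Fin 2]→L[ℝ] ℝ => f ![y, z])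
        (h.transForm_eq (G₀.mul_mem (γ t).2 G₀.one_mem))
    rw [h4] at h3
    exact h3.unique (hasDerivAt_const _ _)
  rw [← hcyc, hzero c hc, hzero a ha, hzero b hb]
  simp

end InvariantForms

end CRSolv

end

/-! ### The theorem -/

theorem proposition2
    {E : Type*} [NormedAddCommGroup E] [NormedSpace ℂ E] [FiniteDimensional ℂ E]
    {E₀ : Type*} [NormedAddCommGroup E₀] [NormedSpace ℝ E₀] [FiniteDimensional ℝ E₀]
    {G : Type*} [Group G] [TopologicalSpace G] [ChartedSpace E G] [LieGroup 𝓘(ℂ, E) ω G]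
    (Γ G₀ : Subgroup G) [DiscreteTopology Γ] [ChartedSpace E₀ G₀] [LieGroup 𝓘(ℝ, E₀) ∞ G₀]
    (hCRS : CRSolv.IsCRS E E₀ Γ G₀) (hK : CRSolv.IsLocallyKahler E Γ G₀) :
    (∃ α₀ : Submodule ℝ (GroupLieAlgebra 𝓘(ℂ, E) G),
      CRSolv.IsSemidirectSum (CRSolv.lieAlg E E₀ G₀) α₀ (CRSolv.complexPart E E₀ G₀) ∧
      CRSolv.bracketSpan ⊤ (CRSolv.complexPart E E₀ G₀) =
        CRSolv.bracketSpan α₀ (CRSolv.complexPart E E₀ G₀)) ∧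
    ∀ (η : CRSolv.TwoForm E G) (U : Set G), CRSolv.IsInvariantKahlerForm G₀ η U →
      CRSolv.IsSemidirectSum (CRSolv.lieAlg E E₀ G₀)
        (CRSolv.orthogonalComplement E₀ G₀ η) (CRSolv.complexPart E E₀ G₀) ∧
      CRSolv.bracketSpan ⊤ (CRSolv.complexPart E E₀ G₀) =
        CRSolv.bracketSpan (CRSolv.orthogonalComplement E₀ G₀ η)
          (CRSolv.complexPart E E₀ G₀) := by
  have : CompleteSpace E := FiniteDimensional.complete ℂ E
  have : LieGroup 𝓘(ℂ, E) ∞ G := inferInstance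
  have : FiniteDimensional ℂ (GroupLieAlgebra 𝓘(ℂ, E) G) := inferInstanceAs (FiniteDimensional ℂ E)
  have : FiniteDimensional ℝ (GroupLieAlgebra 𝓘(ℂ, E) G) := FiniteDimensional.complexToReal _
  have hval := hCRS.smooth_val 1
  have hlie := CRSolv.lie_mem_lieAlg hval
  refine ⟨?_, fun η U h => ?_⟩
  · let : ChartedSpace E (G ⧸ Γ) := CRSolv.quotientChartedSpace Γ
    have : IsManifold 𝓘(ℂ, E) ∞ (G ⧸ Γ) := CRSolv.isManifold_quotient Γ
    have : CompactSpace (G₀ ⧸ Γ.subgroupOf G₀) := hCRS.cocompact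
    have := hCRS.solvable
    obtain ⟨U, η, hU, hmem, hη⟩ := hK
    -- Here `p` is the projection to `G ⧸ Γ`, and `G₀` is solvable as a subgroup of `G`.
    obtain ⟨w, hw, hI, hpos⟩ := CRSolv.exists_averaged_form (K := Γ.subgroupOf G₀)
      inferInstance hval (CRSolv.contMDiff_mk Γ) hη hU (CRSolv.mfderiv_mk_injective Γ) hmem
      fun x k hk => QuotientGroup.mk_mul_of_mem x hk
    exact ⟨_, CRSolv.isSemidirectSum_orthogonal (L := GroupLieAlgebra 𝓘(ℂ, E) G) (w := w) hlie
      hCRS.generic (fun x hx y hy z hz =>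
        (add_right_comm _ _ _).trans (hw x hx z hz y hy)) hI hpos⟩
  · have h1 := h.transForm_eq G₀.one_mem
    have h1' : (1 : G) ∈ U := h.subset G₀.one_mem
    have h2 : CRSolv.orthogonal (L := GroupLieAlgebra 𝓘(ℂ, E) G)
        (CRSolv.transForm id η (1 : G)).toAlternatingMap (CRSolv.lieAlg E E₀ G₀) =
        CRSolv.orthogonalComplement E₀ G₀ η := by
      rw [h1]
      rfl
    rw [← h2]
    exact CRSolv.isSemidirectSum_orthogonal (L := GroupLieAlgebra 𝓘(ℂ, E) G)
      (w := (CRSolv.transForm id η (1 : G)).toAlternatingMap) hlie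
      hCRS.generic (fun x hx y hy z hz =>
        (add_right_comm _ _ _).trans (h.cyclic_sum_eq_zero hval hx hz hy))
      (by rw [h1]; exact h.isKahler.map_I_smul 1 h1') (by rw [h1]; exact h.isKahler.pos 1 h1')
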